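/- **Conventions.** Let $\Bbbk$ be a commutative integral domain. A *weight* of size $n$ is a sequence of $n$ labels $\wedge,\vee$ at the vertices $x=\tfrac12,\tfrac32,\dots,n-\tfrac12$, with an even number of $\wedge$; let $\mathscr P_n$ be the set of these weights. The (decorated) *cup diagram* $\underline\mu$ of $\mu\in\mathscr P_n$ is drawn as follows. Repeatedly join by an undecorated cup a $\vee$ and a $\wedge$ to its right such that all vertices between them are already joined. Then join neighbouring remaining $\wedge\wedge$ pairs, from the left, by decorated cups. Put an undecorated ray at every remaining $\vee$ and a decorated ray at the remaining $\wedge$, if there is one. The left and right vertices of a cup $s$ are denoted $l_s,r_s$. The *cap diagram* $\overline\mu$ is the mirror image of $\underline\mu$. The diagram $\underline\mu\nu$ (equivalently $\nu\overline\mu$) is *oriented* if the labels of $\nu$ at the two ends of a cup are different for undecorated cups and equal for decorated cups, and are $\vee$ at undecorated and $\wedge$ at decorated rays. Its degree is the number of cups whose right vertex is labelled $\vee$. The *generalised Khovanov arc algebra of type $D$*, $\mathbb D_n$, is the free $\Bbbk$-module on the *oriented circle diagrams* $\underline\lambda\nu\overline\mu$ ($\lambda,\nu,\mu\in\mathscr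 P_n$, with $\underline\lambda\nu$ and $\nu\overline\mu$ oriented), graded by $\deg(\underline\lambda\nu)+\deg(\nu\overline\mu)$. Its bilinear product is $(\underline\lambda\nu\overline\alpha)(\underline\beta\gamma\overline\mu)=0$ if $\alpha\ne\beta$. If $\alpha=\beta$, place the second diagram (level $1$) on top of the first (level $0$), and join the rays of $\overline\alpha$ and $\underline\alpha$ to undecorated vertical lines. Perform surgery at the cups $s$ of $\underline\alpha$, one after the other from right to left according to their right vertices: replace $s$ and its mirror cap by two undecorated vertical lines at $l=l_s$ and $r=r_s$. At the end delete the vertical lines. One surgery turns an oriented stacked diagram $(D,\boldsymbol\nu)$ into a combination of orientations of the resulting diagram $D'$, as follows. An orientation is a pair of weights satisfying the above conditions on all cups and caps and on the rays at the southern and northern boundary, with equal labels at the two ends of vertical lines. A component is a *line* if it meets the northern or southern boundary, *propagating* if it meets both, and otherwise a *circle*. Put $\mathrm{orient}(C)=\wedge$ for lines. For circles, $\mathrm{orient}(C)$ is the label at the rightmost vertex of $C$ (the upper one if there are two). Let $\mathrm{sign}[x,y]=1$ if the label at the vertex $x$ on level $y$ equals $\mathrm{orient}$ of its component, and $-1$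 otherwise. Below, orientations are unchanged outside the new components, and a term that would require a line to have $\mathrm{orient}=\vee$ is $0$. The result is $0$ if $D'$ is not orientable. * *Merge* of the components $C_0\ni[l,0]$ and $C_1\ni[l,1]$ into $C$. If $\mathrm{orient}(C_0)=\mathrm{orient}(C_1)=\wedge$, orient $C$ by $\wedge$, with coefficient $1$. If exactly one $C_y$ has orient $\vee$, orient $C$ by $\vee$, with coefficient $\mathrm{sign}_D[l,y]\,\mathrm{sign}_{D'}[l,y]$. If both have orient $\vee$, the result is $0$. * *Split* of $C$ into $C_l\ni[l,1]$ and $C_r\ni[r,1]$. If $\mathrm{orient}(C)=\wedge$, the result is $(-1)^{\lfloor l\rfloor}\bigl(\mathrm{sign}_{D'}[r,1]\,\boldsymbol\nu'\mp\mathrm{sign}_{D'}[l,1]\,\boldsymbol\nu''\bigr)$. Here the sign is $-$ for undecorated $s$ and $+$ for decorated $s$; $\boldsymbol\nu'$ orients $(C_l,C_r)$ by $(\wedge,\vee)$ and $\boldsymbol\nu''$ by $(\vee,\wedge)$. If $\mathrm{orient}(C)=\vee$, the result is $(-1)^{\lfloor l\rfloor}\mathrm{sign}_D[l,1]\,\mathrm{sign}_{D'}[l,1]\,\mathrm{sign}_{D'}[r,1]\,\boldsymbol\nu'''$,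 where $\boldsymbol\nu'''$ orients both by $\vee$. * *Reconnect* (two components become two). The result is $\boldsymbol\nu$ with coefficient $1$ if both components of $D$ are propagating lines, and $0$ otherwise. **Contraction.** Let $n\ge2$ and $0\le k\le n-1$ with $(n,k)\ne(2,1)$. A weight $\lambda\in\mathscr P_n$ is *contractible at $k$* if $\underline\lambda$ has an undecorated cup joining $k-\tfrac12$ and $k+\tfrac12$ (when $k>0$), respectively a decorated cup joining $\tfrac12$ and $\tfrac32$ (when $k=0$). Let $\mathscr P_n^k$ be the set of these weights. For $\lambda\in\mathscr P_n^k$ let $\Phi_k(\lambda)\in\mathscr P_{n-2}$ be the weight obtained by deleting these two vertices, shifting the vertices to their right by $-2$, and, if needed to have an even number of $\wedge$, switching the first remaining label. **Proposition.** Let $\mathbb D_n^k\subseteq\mathbb D_n$ be the $\Bbbk$-span of the oriented circle diagrams $\underline\lambda\nu\overline\mu$ with $\lambda,\nu,\mu\in\mathscr P_n^k$. Then $\mathbb D_n^k$ is closed under multiplication. For every such diagram, $\underline{\Phi_k(\lambda)}\,\Phi_k(\nu)\,\overline{\Phi_k(\mu)}$ is an oriented circle diagram in $\mathbb D_{n-2}$.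 The $\Bbbk$-linear map $$\tilde\Phi_k:\mathbb D_n^k\to\mathbb D_{n-2},\qquad \tilde\Phi_k(\underline\lambda\nu\overline\mu)=\underline{\Phi_k(\lambda)}\,\Phi_k(\nu)\,\overline{\Phi_k(\mu)},$$ is an isomorphism of graded $\Bbbk$-algebras, that is, bijective, multiplicative and degree preserving in both directions. -/

import Mathlib

namespace ArcD

/-! ### Weights

The vertices `x = 1/2, 3/2, …, n - 1/2` are numbered `0, 1, …, n - 1`; so the vertex number `i` sits
at `x = i + 1/2` and `⌊x⌋ = i`. -/

/-- The label `∧`. -/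
abbrev up : Bool := true

/-- The label `∨`. -/
abbrev down : Bool := false

/-- `𝒫_n`: sequences of `n` labels with an even number of `∧`. -/
abbrev Weight (n : ℕ) : Type :=
  {w : Fin n → Bool // Even (Finset.univ.filter fun i => w i = up).card}

/-! ### Decorated cup diagrams -/

/-- The undecorated cups of the cup diagram of `w`. A vertex `i` labelled `∨` is joined to a vertex
`j` on its right labelled `∧` as soon as all vertices strictly between them have been joined
to each other: the vertex `m` in between is an end of the cup `(a m, b m)`. -/
inductive UCup {n : ℕ} (w : Fin n → Bool) : Fin n → Fin n → Prop
  | join (i j : Fin n) (hij : i < j) (hi : w i = down) (hj : w j = up) (a b : Fin n → Fin n)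
      (hab : ∀ m, i < m → m < j → UCup w (a m) (b m))
      (hm : ∀ m, i < m → m < j → i < a m ∧ b m < j ∧ (m = a m ∨ m = b m)) : UCup w i j

/-- The vertex `i` is not on an undecorated cup. -/
def Free {n : ℕ} (w : Fin n → Bool) (i : Fin n) : Prop :=
  ∀ j, ¬ UCup w i j ∧ ¬ UCup w j i

open Classical in
/-- The decorated cups: after the undecorated cups have been drawn, the remaining vertices
labelled `∧` are joined in neighbouring pairs, starting from the left: first with second, third with
fourth, and so on. -/
def DCup {n : ℕ} (w : Fin n → Bool) (i j : Fin n) : Prop :=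
  i < j ∧ Free w i ∧ Free w j ∧ w i = up ∧ w j = up ∧ (∀ m, i < m → m < j → ¬ Free w m) ∧
    Even (Finset.univ.filter fun m => m < i ∧ Free w m ∧ w m = up).card

/-- The cups (decorated or not) of the cup diagram of `w`, given by left and right vertex. -/
def Cup {n : ℕ} (w : Fin n → Bool) (i j : Fin n) : Prop :=
  UCup w i j ∨ DCup w i j

/-- The vertices carrying a ray. The ray is decorated iff the label there is `∧`. -/
def Ray {n : ℕ} (w : Fin n → Bool) (i : Fin n) : Prop :=
  ∀ j, ¬ Cup w i j ∧ ¬ Cup w j i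

/-- `l̲ ν` is an oriented cup diagram (equivalently, `ν l̄` is an oriented cap diagram). The condition
on rays says: `∨` at undecorated rays, `∧` at decorated rays. -/
def Oriented {n : ℕ} (l ν : Fin n → Bool) : Prop :=
  (∀ i j, UCup l i j → ν i ≠ ν j) ∧ (∀ i j, DCup l i j → ν i = ν j) ∧ ∀ i, Ray l i → ν i = l i

open Classical in
/-- The degree of `l̲ ν`: the number of cups whose right vertex is labelled `∨`. -/
noncomputable def cupDegree {n : ℕ} (l ν : Fin n → Bool) : ℕ :=
  (Finset.univ.filter fun c : Fin n × Fin n => Cup l c.1 c.2 ∧ ν c.2 = down).card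

/-! ### Oriented circle diagrams -/

/-- The oriented circle diagrams `l̲ ν m̄`. -/
structure Diagram (n : ℕ) where
  /-- `l`, the weight of the cup diagram -/
  cup : Weight n
  /-- `ν`, the orientation -/
  wt : Weight n
  /-- `m`, the weight of the cap diagram -/
  cap : Weight n
  oriented_cup : Oriented cup.1 wt.1
  oriented_cap : Oriented cap.1 wt.1

/-- The degree of an oriented circle diagram. -/
noncomputable def Diagram.degree {n : ℕ} (x : Diagram n) : ℕ :=
  cupDegree x.cup.1 x.wt.1 + cupDegree x.cap.1 x.wt.1

/-! ### Stacked circle diagrams -/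

/-- The vertex `[x, y]` of a stacked circle diagram: horizontal position and level, where level `0` is
the lower and level `1` the upper weight line. -/
abbrev Vertex (n : ℕ) : Type := Fin n × Fin 2

/-- The stacked circle diagram with cup diagram `l̲` at the bottom, cap diagram `m̄` at the top, and
in the middle `ᾱ α̲` with the cap/cup pairs in `cut` replaced by pairs of undecorated
vertical lines. (The rays of `ᾱ` and `α̲` also join to vertical lines, with an even number of
decorations, that is, undecorated ones.) -/
structure Stacked (n : ℕ) where
  /-- `l`, the weight of the bottom cup diagram -/
  bot : Weight n
  /-- `α`, the weight of the middle part -/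
  mid : Weight n
  /-- `m`, the weight of the top cap diagram -/
  top : Weight n
  /-- the cups of `α̲` on which surgery has been performed -/
  cut : Set (Fin n × Fin n)

/-- A pair `(ν₀, ν₁)` of weights, placed at level `0` and level `1`. -/
abbrev Labelling (n : ℕ) : Type := Fin 2 → Weight n

/-- The symbol at a vertex. -/
def symbolAt {n : ℕ} (o : Labelling n) (v : Vertex n) : Bool := (o v.2).1 v.1

namespace Stacked

variable {n : ℕ}

/-- Surgery at the cup `s` of the middle part. -/
def surgery (D : Stacked n) (s : Fin n × Fin n) : Stacked n :=
  { D with cut := insert s D.cut }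

/-- The pair of vertices `(i, j)` still carries a cap/cup pair in the middle. -/
def MidCup (D : Stacked n) (i j : Fin n) : Prop :=
  Cup D.mid.1 i j ∧ (i, j) ∉ D.cut

/-- There is a vertical line in the middle at position `i`. -/
def Vertical (D : Stacked n) (i : Fin n) : Prop :=
  ∀ j, ¬ D.MidCup i j ∧ ¬ D.MidCup j i

/-- The arcs of the stacked diagram: `[i, y]` and `[j, y']` are the two ends of an arc. -/
def Arc (D : Stacked n) (u v : Vertex n) : Prop :=
  (u.2 = 0 ∧ v.2 = 0 ∧ Cup D.bot.1 u.1 v.1) ∨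
  (u.2 = 1 ∧ v.2 = 1 ∧ Cup D.top.1 u.1 v.1) ∨
  (u.2 = v.2 ∧ D.MidCup u.1 v.1) ∨
  (u.2 = 0 ∧ v.2 = 1 ∧ u.1 = v.1 ∧ D.Vertical u.1)

/-- Two vertices lie on the same connected component. -/
def Conn (D : Stacked n) (u v : Vertex n) : Prop :=
  (SimpleGraph.fromRel D.Arc).Reachable u v

/-- The component of `v` meets the southern boundary. -/
def MeetsSouth (D : Stacked n) (v : Vertex n) : Prop :=
  ∃ i, Ray D.bot.1 i ∧ D.Conn v (i, 0)

/-- The component of `v` meets the northern boundary. -/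
def MeetsNorth (D : Stacked n) (v : Vertex n) : Prop :=
  ∃ i, Ray D.top.1 i ∧ D.Conn v (i, 1)

/-- The component of `v` is a line; otherwise it is a circle. -/
def IsLine (D : Stacked n) (v : Vertex n) : Prop :=
  D.MeetsSouth v ∨ D.MeetsNorth v

/-- The component of `v` is a propagating line. -/
def IsPropagating (D : Stacked n) (v : Vertex n) : Prop :=
  D.MeetsSouth v ∧ D.MeetsNorth v

/-- `o` is an orientation of `D`: undecorated arcs have one end pointing in and one pointing out
(so the two ends of a cup have different symbols, and those of a vertical line equal ones),
decorated arcs have both ends pointing in or both pointing out, undecorated rays at the boundary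
have the symbol `∨` and decorated ones `∧`. -/
def IsOrientation (D : Stacked n) (o : Labelling n) : Prop :=
  Oriented D.bot.1 (o 0).1 ∧ Oriented D.top.1 (o 1).1 ∧
  (∀ i j y, D.MidCup i j → UCup D.mid.1 i j → symbolAt o (i, y) ≠ symbolAt o (j, y)) ∧
  (∀ i j y, D.MidCup i j → DCup D.mid.1 i j → symbolAt o (i, y) = symbolAt o (j, y)) ∧
  ∀ i, D.Vertical i → symbolAt o (i, 0) = symbolAt o (i, 1)

/-- `t` is the tag of the component of `v`: its rightmost vertex, and the northernmost one if there are
two. -/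
def IsTag (D : Stacked n) (v t : Vertex n) : Prop :=
  D.Conn v t ∧ ∀ u, D.Conn v u → u.1 < t.1 ∨ (u.1 = t.1 ∧ u.2 ≤ t.2)

/-- The component of `v` is a circle oriented clockwise, that is, `orient = ∨`. Otherwise
(an anticlockwise circle, or any line) `orient = ∧`. -/
def Clockwise (D : Stacked n) (o : Labelling n) (v : Vertex n) : Prop :=
  ¬ D.IsLine v ∧ ∃ t, D.IsTag v t ∧ symbolAt o t = down

open Classical in
/-- `sign_D [i, y]`: it is `1` if `orient` of the component of `v` matches the symbol at `v`,
and `-1` otherwise. -/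
noncomputable def sign (D : Stacked n) (o : Labelling n) (v : Vertex n) : ℤ :=
  if D.Clockwise o v ↔ symbolAt o v = down then 1 else -1

/-- The labellings `o` and `o'` agree at all vertices outside the components (in `D`) of `u` and `v`. -/
def AgreeOff (D : Stacked n) (u v : Vertex n) (o o' : Labelling n) : Prop :=
  ∀ x, ¬ D.Conn u x → ¬ D.Conn v x → symbolAt o x = symbolAt o' x

open Classical in
/-- The coefficient for a merge at `s = (l, r)`; `D'` is the result of the surgery. -/
noncomputable def mergeCoeff (D D' : Stacked n) (l : Fin n) (o o' : Labelling n) : ℤ :=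
  if D'.AgreeOff (l, 0) (l, 1) o o' then
    if ¬ D.Clockwise o (l, 0) ∧ ¬ D.Clockwise o (l, 1) then
      if ¬ D'.Clockwise o' (l, 0) then 1 else 0
    else if D.Clockwise o (l, 0) ∧ ¬ D.Clockwise o (l, 1) then
      if D'.Clockwise o' (l, 0) then D.sign o (l, 0) * D'.sign o' (l, 0) else 0
    else if ¬ D.Clockwise o (l, 0) ∧ D.Clockwise o (l, 1) then
      if D'.Clockwise o' (l, 0) then D.sign o (l, 1) * D'.sign o' (l, 1) else 0
    else 0
  else 0

open Classical in
/-- The coefficient for a split at `s = (l, r)`; `D'` is the result of the surgery. -/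
noncomputable def splitCoeff (D D' : Stacked n) (l r : Fin n) (o o' : Labelling n) : ℤ :=
  if D'.AgreeOff (l, 1) (r, 1) o o' then
    if ¬ D.Clockwise o (l, 1) then
      if ¬ D'.Clockwise o' (l, 1) ∧ D'.Clockwise o' (r, 1) then
        (-1) ^ (l : ℕ) * D'.sign o' (r, 1)
      else if D'.Clockwise o' (l, 1) ∧ ¬ D'.Clockwise o' (r, 1) then
        (-1) ^ (l : ℕ) * (if DCup D.mid.1 l r then 1 else -1) * D'.sign o' (l, 1)
      else 0
    else
      if D'.Clockwise o' (l, 1) ∧ D'.Clockwise o' (r, 1) then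
        (-1) ^ (l : ℕ) * (D.sign o (l, 1) * D'.sign o' (l, 1) * D'.sign o' (r, 1))
      else 0
  else 0

open Classical in
/-- The coefficient for a reconnection at `s = (l, r)`: the labelling is kept. -/
noncomputable def reconnectCoeff (D : Stacked n) (l : Fin n) (o o' : Labelling n) : ℤ :=
  if o' = o ∧ D.IsPropagating (l, 0) ∧ D.IsPropagating (l, 1) then 1 else 0

open Classical in
/-- Surgery at `s` turns `D` with the orientation `o` into the sum over all orientations `o'` of
`D' = D.surgery s` of `(D', o')` with the coefficient `D.coeff s o o'`.

The cap at level `0` and the cup at level `1` are cut, so surgery only affects their components: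
it is a merge if it turns two components into one, a split if it turns one into two, and a
reconnection if it turns two into two. If `D'` has no orientation, the sum is empty. -/
noncomputable def coeff (D : Stacked n) (s : Fin n × Fin n) (o o' : Labelling n) : ℤ :=
  if (D.surgery s).IsOrientation o' then
    if ¬ D.Conn (s.1, 0) (s.1, 1) ∧ (D.surgery s).Conn (s.1, 0) (s.2, 0) then
      mergeCoeff D (D.surgery s) s.1 o o'
    else if D.Conn (s.1, 0) (s.1, 1) ∧ ¬ (D.surgery s).Conn (s.1, 0) (s.2, 0) then
      splitCoeff D (D.surgery s) s.1 s.2 o o'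
    else if ¬ D.Conn (s.1, 0) (s.1, 1) ∧ ¬ (D.surgery s).Conn (s.1, 0) (s.2, 0) then
      reconnectCoeff D s.1 o o'
    else 0
  else 0

/-- Iterated surgery at the cups in the list, starting from `(D, o)`: the coefficient of the
final labelling `o'`. -/
noncomputable def iterCoeff : List (Fin n × Fin n) → Stacked n → Labelling n → Labelling n → ℤ
  | [], _, o, o' => if o = o' then 1 else 0
  | s :: L, D, o, o' => ∑ o₁ : Labelling n, D.coeff s o o₁ * iterCoeff L (D.surgery s) o₁ o'

end Stacked

open Classical in
/-- The cups of `w`, ordered by their right vertices from right to left. In this order every cup comes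
after the cups that cover it and after the decorated cups to the right of it (which doubly cover
it), so all the intermediate stacked diagrams are admissible. -/
noncomputable def cupsRightToLeft {n : ℕ} (w : Fin n → Bool) : List (Fin n × Fin n) :=
  (List.finRange n).reverse.flatMap fun j =>
    ((List.finRange n).filter fun i => Cup w i j).map fun i => (i, j)

/-! ### The algebra -/

/-- The generalised arc algebra `𝔻_n` over `𝕜`: the free module on the oriented circle diagrams. -/
def ArcAlgebra (𝕜 : Type*) [CommRing 𝕜] (n : ℕ) : Type _ := Diagram n →₀ 𝕜

section Algebra

variable (𝕜 : Type*) [CommRing 𝕜] (n : ℕ)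

noncomputable instance : AddCommGroup (ArcAlgebra 𝕜 n) :=
  inferInstanceAs (AddCommGroup (Diagram n →₀ 𝕜))

noncomputable instance : Module 𝕜 (ArcAlgebra 𝕜 n) :=
  inferInstanceAs (Module 𝕜 (Diagram n →₀ 𝕜))

variable {n}

/-- The basis element of `𝔻_n` given by an oriented circle diagram. -/
noncomputable def diag (x : Diagram n) : ArcAlgebra 𝕜 n :=
  (Finsupp.single x 1 : Diagram n →₀ 𝕜)

open Classical in
/-- The product of two oriented circle diagrams: `(l̲ ν ᾱ) (β̲ γ m̄) = 0` unless `α = β`, and otherwise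
the linear combination of the `l̲ σ m̄` obtained from the stacked diagram by surgery at all the
cups of `α`. After the last surgery only vertical lines are left in the middle, both weights
of the labelling are the same weight `σ`, and the vertical lines are deleted. -/
noncomputable def mulDiag (x y : Diagram n) : ArcAlgebra 𝕜 n :=
  if x.cap = y.cup then
    ∑ σ : Weight n,
      if h : Oriented x.cup.1 σ.1 ∧ Oriented y.cap.1 σ.1 then
        ((Stacked.iterCoeff (cupsRightToLeft x.cap.1) ⟨x.cup, x.cap, y.cap, ∅⟩
          ![x.wt, y.wt] ![σ, σ] : ℤ) : 𝕜) • diag 𝕜 ⟨x.cup, σ, y.cap, h.1, h.2⟩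
      else 0
  else 0

variable (n) in
/-- The multiplication of `𝔻_n`, extended bilinearly from oriented circle diagrams. -/
noncomputable def mulBilin : ArcAlgebra 𝕜 n →ₗ[𝕜] ArcAlgebra 𝕜 n →ₗ[𝕜] ArcAlgebra 𝕜 n :=
  (Finsupp.linearCombination 𝕜 fun x : Diagram n =>
    (Finsupp.linearCombination 𝕜 fun y : Diagram n => mulDiag 𝕜 x y :
      (Diagram n →₀ 𝕜) →ₗ[𝕜] ArcAlgebra 𝕜 n) :
    (Diagram n →₀ 𝕜) →ₗ[𝕜] (Diagram n →₀ 𝕜) →ₗ[𝕜] ArcAlgebra 𝕜 n)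

noncomputable instance : NonUnitalNonAssocRing (ArcAlgebra 𝕜 n) :=
  { (inferInstance : AddCommGroup (ArcAlgebra 𝕜 n)) with
    mul := fun x y => mulBilin 𝕜 n x y
    left_distrib := fun x y z => map_add (mulBilin 𝕜 n x) y z
    right_distrib := fun x y z => LinearMap.map_add₂ (mulBilin 𝕜 n) x y z
    zero_mul := fun x => LinearMap.map_zero₂ (mulBilin 𝕜 n) x
    mul_zero := fun x => map_zero (mulBilin 𝕜 n x) }

instance : IsScalarTower 𝕜 (ArcAlgebra 𝕜 n) (ArcAlgebra 𝕜 n) :=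
  ⟨fun c x y => LinearMap.map_smul₂ (mulBilin 𝕜 n) c x y⟩

instance : SMulCommClass 𝕜 (ArcAlgebra 𝕜 n) (ArcAlgebra 𝕜 n) :=
  ⟨fun c x y => (map_smul (mulBilin 𝕜 n x) c y).symm⟩

/-- The product of two basis elements. -/
theorem diag_mul_diag (x y : Diagram n) : diag 𝕜 x * diag 𝕜 y = mulDiag 𝕜 x y := by
  change (mulBilin 𝕜 n) (diag 𝕜 x) (diag 𝕜 y) = _
  unfold mulBilin diag
  erw [Finsupp.linearCombination_single, one_smul]
  erw [Finsupp.linearCombination_single, one_smul]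

variable (n) in
/-- The homogeneous part of degree `d` of `𝔻_n`. -/
noncomputable def degreePart (d : ℕ) : Submodule 𝕜 (ArcAlgebra 𝕜 n) :=
  Submodule.span 𝕜 {a | ∃ x : Diagram n, x.degree = d ∧ a = diag 𝕜 x}

end Algebra

/-! ### Contraction -/

/-- `w ∈ 𝒫_n^k`: for `k > 0` the cup diagram of `w` has an undecorated cup at the vertices
`x = k - 1/2, k + 1/2` (numbers `k - 1` and `k`); for `k = 0` it has a decorated cup
at the vertices `x = 1/2, 3/2` (numbers `0` and `1`). -/
def Contractible {n : ℕ} (k : ℕ) (w : Fin n → Bool) : Prop :=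
  (0 < k ∧ ∃ i j : Fin n, (i : ℕ) + 1 = k ∧ (j : ℕ) = k ∧ UCup w i j) ∨
  (k = 0 ∧ ∃ i j : Fin n, (i : ℕ) = 0 ∧ (j : ℕ) = 1 ∧ DCup w i j)

/-- The labels left after deletion of the vertices with numbers `k - 1` and `k` (of `0` and `1`
if `k = 0`), shifted to fill the gap. -/
def deleteVertices {m : ℕ} (k : ℕ) (w : Fin (m + 2) → Bool) : Fin m → Bool :=
  fun i => if (i : ℕ) < k - 1 then w (i.castLE (by omega)) else w (i.addNat 2)

/-- Keep `v` if it has an even number of `∧`, and otherwise switch its first label. -/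
def fixParity {m : ℕ} (v : Fin m → Bool) : Fin m → Bool :=
  fun i => if (i : ℕ) = 0 ∧ ¬ Even (Finset.univ.filter fun j => v j = up).card then !v i else v i

theorem even_fixParity {m : ℕ} (v : Fin m → Bool) :
    Even (Finset.univ.filter fun i => fixParity v i = up).card := by
  by_cases h : Even (Finset.univ.filter fun j => v j = up).card
  · simp only [fixParity, h, not_true_eq_false, and_false, if_false]
  · cases m with
    | zero => simp at h
    | succ m =>
      rw [Finset.card_filter, Fin.sum_univ_succ] at h ⊢
      have h0 : fixParity v 0 = !v 0 := by
        simp only [fixParity, Fin.val_zero, true_and]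
        rw [if_pos]
        rwa [Finset.card_filter, Fin.sum_univ_succ]
      have h1 : ∀ i : Fin m, fixParity v i.succ = v i.succ := fun i => by simp [fixParity]
      simp only [h0, h1]
      cases hv : v 0 <;> simp only [hv] at h ⊢ <;> simp [Nat.even_add_one, add_comm 1] at h ⊢ <;>
        simpa using h

/-- The contraction map `Φ_k` on weights: delete the two vertices and reorient the first of the
remaining vertices if this is needed for an even number of `∧`. -/
def contract {m : ℕ} (k : ℕ) (w : Weight (m + 2)) : Weight m :=
  ⟨fixParity (deleteVertices k w.1), even_fixParity _⟩

/-- All three weights of the oriented circle diagram are contractible at `k`. -/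
def Diagram.Contractible {n : ℕ} (k : ℕ) (x : Diagram n) : Prop :=
  ArcD.Contractible k x.cup.1 ∧ ArcD.Contractible k x.wt.1 ∧ ArcD.Contractible k x.cap.1

end ArcD

/-!
Contraction at `k` removes a cup joining two neighbouring vertices from each of the three weights
of an oriented circle diagram. In the diagram these vertices carry one small circle, labelled `∧`
at its right vertex, so it is anticlockwise and contributes nothing to the degree.

*Cup diagrams.* On the remaining vertices the cup diagram of a contractible weight is that of the
restricted label sequence (`uCup_skip_iff`, `dCup_skip_iff`). For `k > 0` restriction changes the
parity of the number of `∧`, and the first label is switched. This switches the decoration of the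
arc at the first vertex and nothing else (`uCup_flipFirst`, `dCup_flipFirst`), because that vertex
is either the left end of an undecorated cup or ray, or the first of the free vertices labelled
`∧`. So contraction preserves cups and rays as a planar diagram, orientations and degrees, and it
is a bijection from contractible weights to all weights of size `m` (`contracts_contract`,
`exists_contracts`).

*Surgery at other cups.* No component of a stacked diagram contains both deleted and remaining
vertices (`StackContracts.isDel_iff_of_conn`), and the part on the remaining vertices is
isomorphic to the contracted stacked diagram (`StackContracts.conn_skipV_iff`). Types of surgery
and orientations of components agree. The only effect of switching the first label is on signs at
the first vertex, as the tag of a circle is never there (`Stacked.IsTag.ne_zero`); the signs at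
this vertex occur in pairs, except in a split of an anticlockwise circle, where the change of sign
is compensated by the change of decoration of the cup. So the coefficients agree
(`StackContracts.coeff_eq`).

*Surgery at the deleted cup.* It merges two anticlockwise circles on the deleted vertices and
hence keeps the orientation with coefficient `1` (`StackContracts.coeff_del`). Therefore all
iterated coefficients agree, and those of labellings that are not contractible vanish
(`ListContracts.iterCoeff_eq`).

The inverse of the contraction is thus an injective homomorphism of algebras `𝔻_m → 𝔻_{m+2}`
(`expandHom`) whose range is the span of the contractible diagrams, and the isomorphism is the
inverse of its corestriction to the range.
-/

namespace ArcD

/-! ### Undecorated cups -/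

section Cups

variable {n : ℕ} {w : Fin n → Bool} {i j : Fin n}

theorem UCup.lt (h : UCup w i j) : i < j := by cases h; assumption

theorem UCup.left_eq (h : UCup w i j) : w i = down := by cases h; assumption

theorem UCup.right_eq (h : UCup w i j) : w j = up := by cases h; assumption

theorem UCup.exists_between (h : UCup w i j) {m : Fin n} (him : i < m) (hmj : m < j) :
    ∃ a b, UCup w a b ∧ i < a ∧ b < j ∧ (m = a ∨ m = b) := by
  cases h with
  | join _ _ _ _ _ a b hab hm => exact ⟨a m, b m, hab m him hmj, hm m him hmj⟩

theorem UCup.of_exists (hij : i < j) (hi : w i = down) (hj : w j = up)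
    (h : ∀ m, i < m → m < j → ∃ a b, UCup w a b ∧ i < a ∧ b < j ∧ (m = a ∨ m = b)) :
    UCup w i j := by
  have : Nonempty (Fin n) := ⟨i⟩
  choose! a b hab using h
  exact .join i j hij hi hj a b (fun m h₁ h₂ => (hab m h₁ h₂).1)
    (fun m h₁ h₂ => (hab m h₁ h₂).2)

theorem UCup.exists_of_down (h : UCup w i j) {m : Fin n} (him : i < m) (hmj : m < j)
    (hm : w m = down) : ∃ b, UCup w m b ∧ b < j := by
  obtain ⟨a, b, hab, -, hb, rfl | rfl⟩ := h.exists_between him hmj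
  · exact ⟨b, hab, hb⟩
  · simp [hab.right_eq] at hm

theorem UCup.exists_of_up (h : UCup w i j) {m : Fin n} (him : i < m) (hmj : m < j)
    (hm : w m = up) : ∃ a, UCup w a m ∧ i < a := by
  obtain ⟨a, b, hab, ha, -, rfl | rfl⟩ := h.exists_between him hmj
  · simp [hab.left_eq] at hm
  · exact ⟨a, hab, ha⟩

theorem UCup.not_lt_of_left {j' : Fin n} (h : UCup w i j) (h' : UCup w i j') : ¬ j < j' := by
  intro hlt
  -- A second, longer cup at `i` forces two cups at a vertex in its interior: infinite descent.
  induction hd : (j' : ℕ) - i using Nat.strong_induction_on generalizing i j j' with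
  | _ d ih =>
    obtain ⟨a, ha, hia⟩ := h'.exists_of_up h.lt hlt h.right_eq
    obtain ⟨b, hb, hbj⟩ := h.exists_of_down hia ha.lt ha.left_eq
    have := ha.lt
    exact ih ((j : ℕ) - a) (by omega) hb ha hbj rfl

theorem UCup.right_unique {j' : Fin n} (h : UCup w i j) (h' : UCup w i j') : j = j' :=
  le_antisymm (not_lt.1 (h'.not_lt_of_left h)) (not_lt.1 (h.not_lt_of_left h'))

theorem UCup.left_unique {i' : Fin n} (h : UCup w i j) (h' : UCup w i' j) : i = i' := by
  have key : ∀ {i i'}, UCup w i j → UCup w i' j → ¬ i < i' := by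
    intro i i' h h' hlt
    obtain ⟨b, hb, hbj⟩ := h.exists_of_down hlt h'.lt h'.left_eq
    exact hb.not_lt_of_left h' hbj
  exact le_antisymm (not_lt.1 (key h' h)) (not_lt.1 (key h h'))

theorem UCup.not_free_of_between (h : UCup w i j) {m : Fin n} (him : i < m) (hmj : m < j) :
    ¬ Free w m := by
  obtain ⟨a, b, hab, -, -, rfl | rfl⟩ := h.exists_between him hmj
  · exact fun hf => (hf b).1 hab
  · exact fun hf => (hf a).2 hab

theorem exists_uCup_of_not_free (h : ¬ Free w i) : ∃ a b, UCup w a b ∧ (i = a ∨ i = b) := by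
  simp only [Free, not_forall, not_and_or, not_not] at h
  obtain ⟨x, hx | hx⟩ := h
  · exact ⟨i, x, hx, .inl rfl⟩
  · exact ⟨x, i, hx, .inr rfl⟩

/-- Undecorated cups do not cross: a cup with an end between two free vertices stays between. -/
theorem exists_uCup_between (hi : Free w i) (hj : Free w j) {m : Fin n} (him : i < m) (hmj : m < j)
    (hm : ¬ Free w m) : ∃ a b, UCup w a b ∧ i < a ∧ b < j ∧ (m = a ∨ m = b) := by
  obtain ⟨a, b, hab, h⟩ := exists_uCup_of_not_free hm
  have := hab.lt
  refine ⟨a, b, hab, ?_, ?_, h⟩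
  · by_contra hia
    rcases eq_or_lt_of_le (not_lt.1 hia) with rfl | hai
    · exact (hi b).1 hab
    · exact hab.not_free_of_between hai (by rcases h with rfl | rfl <;> omega) hi
  · by_contra hbj
    rcases eq_or_lt_of_le (not_lt.1 hbj) with rfl | hjb
    · exact (hj a).2 hab
    · exact hab.not_free_of_between (by rcases h with rfl | rfl <;> omega) hjb hj

/-- To the right of an undecorated ray there are only undecorated rays. -/
theorem Free.false_of_down_up (hi : Free w i) (hj : Free w j) (hij : i < j) (hwi : w i = down)
    (hwj : w j = up) : False := by
  induction hd : (j : ℕ) - i using Nat.strong_induction_on generalizing i j with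
  | _ d ih =>
    by_cases hfree : ∃ m, i < m ∧ m < j ∧ Free w m
    · obtain ⟨m, him, hmj, hm⟩ := hfree
      cases hwm : w m
      · exact ih ((j : ℕ) - m) (by omega) hm hj hmj hwm hwj rfl
      · exact ih ((m : ℕ) - i) (by omega) hi hm him hwi hwm rfl
    · push Not at hfree
      exact (hi j).1 (.of_exists hij hwi hwj fun m h₁ h₂ =>
        exists_uCup_between hi hj h₁ h₂ (hfree m h₁ h₂))

theorem Cup.lt (h : Cup w i j) : i < j := h.elim UCup.lt fun h => h.1

end Cups

/-! ### Switching the first label -/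

/-- Switch the label of the vertex number `0`. -/
def flipFirst {n : ℕ} (w : Fin n → Bool) : Fin n → Bool :=
  fun i => if (i : ℕ) = 0 then !w i else w i

section Flip

variable {n : ℕ} {w : Fin n → Bool} {i j : Fin n}

theorem flipFirst_zero (hi : (i : ℕ) = 0) : flipFirst w i = !w i := if_pos hi

theorem flipFirst_of_ne (hi : (i : ℕ) ≠ 0) : flipFirst w i = w i := if_neg hi

@[simp] theorem flipFirst_flipFirst (w : Fin n → Bool) : flipFirst (flipFirst w) = w := by
  ext i; by_cases h : (i : ℕ) = 0 <;> simp [flipFirst, h]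

theorem UCup.flipFirst (h : UCup w i j) (hi : (i : ℕ) ≠ 0) : UCup (flipFirst w) i j := by
  induction h with
  | join i j hij hwi hwj a b hab hm ih =>
    refine .join i j hij ?_ ?_ a b (fun m h₁ h₂ => ih m h₁ h₂ ?_) hm
    · rwa [flipFirst_of_ne hi]
    · rwa [flipFirst_of_ne (by omega)]
    · have := (hm m h₁ h₂).1
      omega

theorem UCup.of_flipFirst (h : UCup (ArcD.flipFirst w) i j) (hi : (i : ℕ) ≠ 0) : UCup w i j := by
  simpa using h.flipFirst hi

theorem UCup.dCup_flipFirst (h : UCup w i j) (hi : (i : ℕ) = 0) :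
    DCup (ArcD.flipFirst w) i j := by
  have hij := h.lt
  have hwi : ArcD.flipFirst w i = up := by rw [flipFirst_zero hi, h.left_eq]; rfl
  have hwj : ArcD.flipFirst w j = up := by rw [flipFirst_of_ne (by omega), h.right_eq]
  refine ⟨hij, fun x => ⟨fun hx => ?_, fun hx => ?_⟩, fun x => ⟨fun hx => ?_, fun hx => ?_⟩,
    hwi, hwj, fun m h₁ h₂ => ?_, ?_⟩
  · simp [hx.left_eq] at hwi
  · have := hx.lt; omega
  · simp [hx.left_eq] at hwj
  · have hx0 : (x : ℕ) ≠ 0 := fun hx0 => by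
      rw [← Fin.ext (hx0.trans hi.symm), hx.left_eq] at hwi; simp at hwi
    have := (hx.of_flipFirst hx0).left_unique h
    omega
  · obtain ⟨a, b, hab, hia, -, rfl | rfl⟩ := h.exists_between h₁ h₂
    · exact fun hf => (hf b).1 (hab.flipFirst (by omega))
    · exact fun hf => (hf a).2 (hab.flipFirst (by omega))
  · rw [Finset.card_eq_zero.2]
    · exact Even.zero
    · ext m
      have : ¬ m < i := by omega
      simp [this]

theorem DCup.uCup_flipFirst (h : DCup w i j) (hi : (i : ℕ) = 0) :
    UCup (ArcD.flipFirst w) i j := by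
  obtain ⟨hij, hfi, hfj, hwi, hwj, hb, -⟩ := h
  refine .of_exists hij ?_ ?_ fun m h₁ h₂ => ?_
  · rw [flipFirst_zero hi, hwi]; rfl
  · rw [flipFirst_of_ne (by omega), hwj]
  · obtain ⟨a, b, hab, ha, hb, hm⟩ := exists_uCup_between hfi hfj h₁ h₂ (hb m h₁ h₂)
    exact ⟨a, b, hab.flipFirst (by omega), ha, hb, hm⟩

theorem Free.flipFirst (h : Free w i) (hi : (i : ℕ) ≠ 0)
    (h0 : ∀ x : Fin n, (x : ℕ) = 0 → ¬ DCup w x i) : Free (flipFirst w) i := by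
  refine fun x => ⟨fun hx => (h x).1 (hx.of_flipFirst hi), fun hx => ?_⟩
  by_cases hx0 : (x : ℕ) = 0
  · exact h0 x hx0 (by simpa using hx.dCup_flipFirst hx0)
  · exact (h x).2 (hx.of_flipFirst hx0)

open Classical in
/-- Switching the first label from `∨` to `∧` turns both ends of the cup at the first vertex into free
vertices labelled `∧`, and changes nothing else about freeness. -/
theorem even_card_free_flipFirst_of_down (hi : Free w i) (hwi : w i = up) {z : Fin n}
    (hz : (z : ℕ) = 0) (hzi : z < i) (hwz : w z = down) :
    (Even (Finset.univ.filter fun m => m < i ∧ Free (flipFirst w) m ∧ flipFirst w m = up).card ↔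
      Even (Finset.univ.filter fun m => m < i ∧ Free w m ∧ w m = up).card) := by
  have hfz : ¬ Free w z := fun hf => hf.false_of_down_up hi hzi hwz hwi
  obtain ⟨a, b, hab, hab'⟩ := exists_uCup_of_not_free hfz
  have hlt := hab.lt
  obtain rfl : z = a := by
    rcases hab' with h | rfl
    · exact h
    · omega
  have hbi : b < i := by
    rcases lt_trichotomy b i with h | rfl | h
    · exact h
    · exact ((hi z).2 hab).elim
    · exact (hab.not_free_of_between hzi h hi).elim
  obtain ⟨-, hz', hb', hwz', hwb', -, -⟩ := hab.dCup_flipFirst hz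
  have hset : (Finset.univ.filter fun m => m < i ∧ Free (flipFirst w) m ∧ flipFirst w m = up) =
      insert z (insert b (Finset.univ.filter fun m => m < i ∧ Free w m ∧ w m = up)) := by
    ext m
    simp only [Finset.mem_filter, Finset.mem_univ, true_and, Finset.mem_insert]
    constructor
    · rintro ⟨hmi, hm, hwm⟩
      by_cases hmz : m = z
      · exact .inl hmz
      by_cases hmb : m = b
      · exact .inr (.inl hmb)
      have hm0 : (m : ℕ) ≠ 0 := fun h => hmz (Fin.ext (h.trans hz.symm))
      refine .inr (.inr ⟨hmi, fun x => ⟨fun hx => (hm x).1 (hx.flipFirst hm0), fun hx => ?_⟩, ?_⟩)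
      · by_cases hx0 : (x : ℕ) = 0
        · obtain rfl : x = z := Fin.ext (hx0.trans hz.symm)
          exact hmb (hx.right_unique hab)
        · exact (hm x).2 (hx.flipFirst hx0)
      · rwa [flipFirst_of_ne hm0] at hwm
    · rintro (rfl | rfl | ⟨hmi, hm, hwm⟩)
      · exact ⟨hzi, hz', hwz'⟩
      · exact ⟨hbi, hb', hwb'⟩
      · have hm0 : (m : ℕ) ≠ 0 := fun h => by
          rw [Fin.ext (h.trans hz.symm), hwz] at hwm; simp at hwm
        refine ⟨hmi, hm.flipFirst hm0 fun x hx hD => ?_, ?_⟩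
        · rw [Fin.ext (hx.trans hz.symm)] at hD
          have := hD.2.2.2.1
          simp [hwz] at this
        · rwa [flipFirst_of_ne hm0]
  rw [hset, Finset.card_insert_of_notMem, Finset.card_insert_of_notMem]
  · simp [Nat.even_add_one]
  · simp only [Finset.mem_filter, Finset.mem_univ, true_and, not_and]
    exact fun _ hf => ((hf z).2 hab).elim
  · simp only [Finset.mem_insert, Finset.mem_filter, Finset.mem_univ, true_and, not_or]
    exact ⟨hlt.ne, fun h => hfz h.2.1⟩

theorem DCup.flipFirst (h : DCup w i j) (hi : (i : ℕ) ≠ 0) : DCup (flipFirst w) i j := by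
  classical
  obtain ⟨hij, hfi, hfj, hwi, hwj, hb, hev⟩ := h
  have hfi' : Free (ArcD.flipFirst w) i := hfi.flipFirst hi fun x hx hD => by
    -- A decorated cup from the first vertex to `i` would leave an odd number of free `∧` before `i`.
    obtain ⟨hxi, hfx, -, hwx, -, hbx, -⟩ := hD
    have : (Finset.univ.filter fun m => m < i ∧ Free w m ∧ w m = up) = {x} := by
      ext m
      simp only [Finset.mem_filter, Finset.mem_univ, true_and, Finset.mem_singleton]
      refine ⟨fun hm => ?_, by rintro rfl; exact ⟨hxi, hfx, hwx⟩⟩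
      by_contra hne
      exact hbx m (by have : (m : ℕ) ≠ x := fun h => hne (Fin.ext h)
                      omega) hm.1 hm.2.1
    convert_to Even ({x} : Finset (Fin n)).card at hev
    · rw [← this]
    · simp at hev
  have hfj' : Free (ArcD.flipFirst w) j := hfj.flipFirst (by omega) fun x hx hD =>
    hD.2.2.2.2.2.1 i (by omega) hij hfi
  refine ⟨hij, hfi', hfj', ?_, ?_, fun m h₁ h₂ => ?_, ?_⟩
  · rwa [flipFirst_of_ne hi]
  · rwa [flipFirst_of_ne (by omega)]
  · obtain ⟨a, b, hab, ha, -, rfl | rfl⟩ := exists_uCup_between hfi hfj h₁ h₂ (hb m h₁ h₂)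
    · exact fun hf => (hf b).1 (hab.flipFirst (by omega))
    · exact fun hf => (hf a).2 (hab.flipFirst (by omega))
  · let z : Fin n := ⟨0, by omega⟩
    have hzi : z < i := Fin.lt_def.2 (Nat.pos_of_ne_zero hi)
    -- The parity statement is symmetric in `w` and its switched version, one of which has `∨` at `z`.
    cases hwz : w z
    · convert (even_card_free_flipFirst_of_down hfi hwi rfl hzi hwz).2 (by convert hev)
    · have := even_card_free_flipFirst_of_down (w := ArcD.flipFirst w) hfi'
        (by rwa [flipFirst_of_ne hi]) rfl hzi (by rw [flipFirst_zero rfl, hwz]; rfl)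
      rw [flipFirst_flipFirst] at this
      convert this.1 (by convert hev)

/-- Switching the first label switches the decoration of the arc at the first vertex. -/
theorem uCup_flipFirst :
    UCup (flipFirst w) i j ↔ if (i : ℕ) = 0 then DCup w i j else UCup w i j := by
  split_ifs with hi
  · exact ⟨fun h => by simpa using h.dCup_flipFirst hi, fun h => h.uCup_flipFirst hi⟩
  · exact ⟨fun h => h.of_flipFirst hi, fun h => h.flipFirst hi⟩

theorem dCup_flipFirst :
    DCup (flipFirst w) i j ↔ if (i : ℕ) = 0 then UCup w i j else DCup w i j := by
  split_ifs with hi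
  · exact ⟨fun h => by simpa using h.uCup_flipFirst hi, fun h => h.dCup_flipFirst hi⟩
  · exact ⟨fun h => by simpa using h.flipFirst hi, fun h => h.flipFirst hi⟩

end Flip

/-! ### Deleting two neighbouring vertices -/

section Delete

variable {m k : ℕ}

/-- The order embedding of the remaining vertices, which skips the two deleted ones. -/
def skip (m k : ℕ) (i : Fin m) : Fin (m + 2) :=
  if (i : ℕ) < k - 1 then i.castLE (by omega) else i.addNat 2

/-- The left one of the two deleted vertices. -/
def delL (hk : k < m + 2) : Fin (m + 2) := ⟨k - 1, by omega⟩

/-- The right one of the two deleted vertices. -/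
def delR (hk : k < m + 2) : Fin (m + 2) := ⟨k - 1 + 1, by omega⟩

theorem val_skip (i : Fin m) : (skip m k i : ℕ) = if (i : ℕ) < k - 1 then (i : ℕ) else i + 2 := by
  unfold skip; split_ifs <;> simp

theorem val_delL (hk : k < m + 2) : (delL hk : ℕ) = k - 1 := rfl

theorem val_delR (hk : k < m + 2) : (delR hk : ℕ) = k - 1 + 1 := rfl

theorem delL_lt_delR (hk : k < m + 2) : delL hk < delR hk := by
  simp [Fin.lt_def, val_delL, val_delR]

theorem delL_ne_delR (hk : k < m + 2) : delL hk ≠ delR hk := (delL_lt_delR hk).ne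

theorem skip_lt_skip {i j : Fin m} : skip m k i < skip m k j ↔ i < j := by
  rw [Fin.lt_def, Fin.lt_def, val_skip, val_skip]; split_ifs <;> omega

theorem skip_inj {i j : Fin m} : skip m k i = skip m k j ↔ i = j := by
  rw [Fin.ext_iff, Fin.ext_iff, val_skip, val_skip]; split_ifs <;> omega

theorem skip_injective : Function.Injective (skip m k) := fun _ _ h => skip_inj.1 h

theorem skip_ne_delL (hk : k < m + 2) (i : Fin m) : skip m k i ≠ delL hk := by
  rw [Ne, Fin.ext_iff, val_skip, val_delL]; split_ifs <;> omega

theorem skip_ne_delR (hk : k < m + 2) (i : Fin m) : skip m k i ≠ delR hk := by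
  rw [Ne, Fin.ext_iff, val_skip, val_delR]; split_ifs <;> omega

theorem skip_lt_delR (hk : k < m + 2) {i : Fin m} : skip m k i < delR hk ↔ skip m k i < delL hk := by
  rw [Fin.lt_def, Fin.lt_def, val_skip, val_delR, val_delL]; split_ifs <;> omega

theorem delR_lt_skip (hk : k < m + 2) {i : Fin m} : delR hk < skip m k i ↔ delL hk < skip m k i := by
  rw [Fin.lt_def, Fin.lt_def, val_skip, val_delR, val_delL]; split_ifs <;> omega

theorem not_between_del (hk : k < m + 2) (x : Fin (m + 2)) : ¬ (delL hk < x ∧ x < delR hk) := by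
  rw [Fin.lt_def, Fin.lt_def, val_delR, val_delL]; omega

theorem eq_del_or_skip (hk : k < m + 2) (x : Fin (m + 2)) :
    x = delL hk ∨ x = delR hk ∨ ∃ i, x = skip m k i := by
  rcases lt_or_ge (x : ℕ) (k - 1) with h | h
  · exact .inr (.inr ⟨⟨x, by omega⟩, Fin.ext (by rw [val_skip, if_pos]; exact h)⟩)
  · by_cases h1 : (x : ℕ) = k - 1
    · exact .inl (Fin.ext h1)
    by_cases h2 : (x : ℕ) = k - 1 + 1
    · exact .inr (.inl (Fin.ext h2))
    refine .inr (.inr ⟨⟨x - 2, by omega⟩, Fin.ext ?_⟩)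
    rw [val_skip, if_neg (by simp only; omega)]
    simp only
    omega

/-- The list of all vertices in order, split at the two deleted ones. -/
theorem exists_finRange_eq (hk : k < m + 2) : ∃ A B : List (Fin m), List.finRange m = A ++ B ∧
    List.finRange (m + 2) = A.map (skip m k) ++ delL hk :: delR hk :: B.map (skip m k) := by
  refine ⟨(List.finRange m).filter fun i => (i : ℕ) < k - 1,
    (List.finRange m).filter fun i => ¬ (i : ℕ) < k - 1, ?_, ?_⟩
  · refine List.Perm.eq_of_pairwise (le := (· < ·)) (fun a b _ _ h h' => (lt_asymm h h').elim)
      (List.pairwise_lt_finRange m) ?_ ?_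
    · refine List.pairwise_append.2 ⟨(List.pairwise_lt_finRange m).filter _,
        (List.pairwise_lt_finRange m).filter _, fun a ha b hb => ?_⟩
      simp at ha hb
      exact Fin.lt_def.2 (by omega)
    · rw [List.perm_ext_iff_of_nodup (List.nodup_finRange m)]
      · intro a; simp; omega
      · refine List.Nodup.append ((List.nodup_finRange m).filter _)
          ((List.nodup_finRange m).filter _) fun a ha hb => ?_
        simp at ha hb
        omega
  · have hpw : (((List.finRange m).filter fun i : Fin m => (i : ℕ) < k - 1).map (skip m k) ++
        delL hk :: delR hk ::
        ((List.finRange m).filter fun i : Fin m => ¬ (i : ℕ) < k - 1).map (skip m k)).Pairwise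
          (· < ·) := by
      refine List.pairwise_append.2 ⟨?_, ?_, fun a ha b hb => ?_⟩
      · exact ((List.pairwise_lt_finRange m).filter _).map _ fun _ _ => skip_lt_skip.2
      · refine List.pairwise_cons.2 ⟨fun a ha => ?_, List.pairwise_cons.2 ⟨fun a ha => ?_, ?_⟩⟩
        · simp only [List.mem_cons, List.mem_map, List.mem_filter, List.mem_finRange, true_and,
            decide_eq_true_eq] at ha
          obtain rfl | ⟨i, hi, rfl⟩ := ha
          · exact delL_lt_delR hk
          · rw [Fin.lt_def, val_delL, val_skip, if_neg hi]; omega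
        · simp only [List.mem_map, List.mem_filter, List.mem_finRange, true_and,
            decide_eq_true_eq] at ha
          obtain ⟨i, hi, rfl⟩ := ha
          rw [Fin.lt_def, val_delR, val_skip, if_neg hi]; omega
        · exact ((List.pairwise_lt_finRange m).filter _).map _ fun _ _ => skip_lt_skip.2
      · simp only [List.mem_cons, List.mem_map, List.mem_filter, List.mem_finRange, true_and,
          decide_eq_true_eq] at ha hb
        obtain ⟨i, hi, rfl⟩ := ha
        rw [Fin.lt_def, val_skip, if_pos hi]
        obtain rfl | rfl | ⟨j, hj, rfl⟩ := hb
        · rw [val_delL]; omega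
        · rw [val_delR]; omega
        · rw [val_skip, if_neg hj]; omega
    refine List.Perm.eq_of_pairwise (le := (· < ·)) (fun a b _ _ h h' => (lt_asymm h h').elim)
      (List.pairwise_lt_finRange _) hpw ?_
    rw [List.perm_ext_iff_of_nodup (List.nodup_finRange _) (hpw.imp fun h => h.ne)]
    intro a
    simp only [List.mem_finRange, List.mem_append, List.mem_cons, List.mem_map, List.mem_filter,
      true_and, decide_eq_true_eq, true_iff]
    obtain rfl | rfl | ⟨i, rfl⟩ := eq_del_or_skip hk a
    · simp
    · simp
    · by_cases hi : (i : ℕ) < k - 1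
      · exact .inl ⟨i, hi, rfl⟩
      · exact .inr (.inr (.inr ⟨i, hi, rfl⟩))

theorem sum_eq_del_add_skip (hk : k < m + 2) (f : Fin (m + 2) → ℕ) :
    ∑ x, f x = f (delL hk) + f (delR hk) + ∑ i, f (skip m k i) := by
  obtain ⟨A, B, h, h'⟩ := exists_finRange_eq hk
  rw [Fin.sum_univ_def, Fin.sum_univ_def, h, h']
  simp [Function.comp_def]
  omega

open Classical in
theorem card_filter_eq_del_add_skip (hk : k < m + 2) (P : Fin (m + 2) → Prop) :
    (Finset.univ.filter P).card = (if P (delL hk) then 1 else 0) + (if P (delR hk) then 1 else 0) +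
      (Finset.univ.filter fun i => P (skip m k i)).card := by
  simp only [Finset.card_filter]
  exact sum_eq_del_add_skip hk _

theorem deleteVertices_eq (w : Fin (m + 2) → Bool) : deleteVertices k w = w ∘ skip m k := by
  ext i
  simp only [deleteVertices, skip, Function.comp]
  split_ifs <;> rfl

/-- The labels at the two vertices to be deleted: `∨∧`, or `∧∧` if `k = 0`. -/
def DelLabels (hk : k < m + 2) (w : Fin (m + 2) → Bool) : Prop :=
  w (delL hk) = decide (k = 0) ∧ w (delR hk) = up

variable {hk : k < m + 2} {w : Fin (m + 2) → Bool}

theorem DelLabels.left_eq_up (h : DelLabels hk w) (h0 : k = 0) : w (delL hk) = up := by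
  rw [h.1, decide_eq_true h0]

theorem UCup.of_delLabels (h : DelLabels hk w) (h0 : 0 < k) : UCup w (delL hk) (delR hk) := by
  refine .of_exists (delL_lt_delR hk) ?_ h.2 fun x h₁ h₂ => (not_between_del hk x ⟨h₁, h₂⟩).elim
  rw [h.1, decide_eq_false h0.ne']

theorem not_uCup_of_zero (h : DelLabels hk w) (h0 : k = 0) (x : Fin (m + 2)) :
    ¬ UCup w (delL hk) x ∧ ¬ UCup w x (delL hk) ∧ ¬ UCup w (delR hk) x ∧ ¬ UCup w x (delR hk) := by
  have h1 : w (delL hk) = up := h.left_eq_up h0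
  have key : ∀ x, ¬ UCup w (delL hk) x := fun x hx => by simp [hx.left_eq] at h1
  refine ⟨key x, fun hx => ?_, fun hx => ?_, fun hx => ?_⟩
  · have := Fin.lt_def.1 hx.lt; rw [val_delL] at this; omega
  · have := h.2; simp [hx.left_eq] at this
  · have := Fin.lt_def.1 hx.lt
    rw [val_delR] at this
    obtain rfl : x = delL hk := Fin.ext (by rw [val_delL]; omega)
    exact key _ hx

theorem uCup_delL (h : DelLabels hk w) {x : Fin (m + 2)} (hx : UCup w (delL hk) x) :
    x = delR hk := by
  rcases Nat.eq_zero_or_pos k with h0 | h0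
  · exact ((not_uCup_of_zero h h0 x).1 hx).elim
  · exact hx.right_unique (.of_delLabels h h0)

theorem uCup_delR (h : DelLabels hk w) {x : Fin (m + 2)} (hx : UCup w x (delR hk)) :
    x = delL hk := by
  rcases Nat.eq_zero_or_pos k with h0 | h0
  · exact ((not_uCup_of_zero h h0 x).2.2.2 hx).elim
  · exact hx.left_unique (.of_delLabels h h0)

theorem not_uCup_right_delL (h : DelLabels hk w) (x : Fin (m + 2)) : ¬ UCup w x (delL hk) := by
  rcases Nat.eq_zero_or_pos k with h0 | h0
  · exact (not_uCup_of_zero h h0 x).2.1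
  · intro hx
    have := hx.right_eq
    simp [(UCup.of_delLabels h h0).left_eq] at this

theorem not_uCup_left_delR (h : DelLabels hk w) (x : Fin (m + 2)) : ¬ UCup w (delR hk) x := by
  intro hx
  have := h.2
  simp [hx.left_eq] at this

theorem uCup_cases (h : DelLabels hk w) {x y : Fin (m + 2)} (hxy : UCup w x y) :
    (0 < k ∧ x = delL hk ∧ y = delR hk) ∨ ∃ i j, x = skip m k i ∧ y = skip m k j := by
  obtain rfl | rfl | ⟨i, rfl⟩ := eq_del_or_skip hk x
  · refine .inl ⟨Nat.pos_of_ne_zero fun h0 => (not_uCup_of_zero h h0 y).1 hxy, rfl,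
      uCup_delL h hxy⟩
  · exact (not_uCup_left_delR h y hxy).elim
  obtain rfl | rfl | ⟨j, rfl⟩ := eq_del_or_skip hk y
  · exact (not_uCup_right_delL h _ hxy).elim
  · exact (skip_ne_delL hk i (uCup_delR h hxy)).elim
  · exact .inr ⟨i, j, rfl, rfl⟩

theorem uCup_skip_iff (h : DelLabels hk w) {i j : Fin m} :
    UCup w (skip m k i) (skip m k j) ↔ UCup (w ∘ skip m k) i j := by
  constructor
  · intro hij
    induction hd : (j : ℕ) - i using Nat.strong_induction_on generalizing i j with
    | _ d ih =>
      refine .of_exists (skip_lt_skip.1 hij.lt) hij.left_eq hij.right_eq fun x h₁ h₂ => ?_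
      obtain ⟨a, b, hab, ha, hb, hx⟩ :=
        hij.exists_between (skip_lt_skip (k := k).2 h₁) (skip_lt_skip (k := k).2 h₂)
      obtain ⟨-, rfl, rfl⟩ | ⟨a, b, rfl, rfl⟩ := uCup_cases h hab
      · exact (hx.elim (skip_ne_delL hk _) (skip_ne_delR hk _)).elim
      · rw [skip_lt_skip] at ha hb
        rw [skip_inj, skip_inj] at hx
        exact ⟨a, b, ih _ (by omega) hab rfl, ha, hb, hx⟩
  · intro hij
    induction hd : (j : ℕ) - i using Nat.strong_induction_on generalizing i j with
    | _ d ih =>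
      refine .of_exists (skip_lt_skip.2 hij.lt) hij.left_eq hij.right_eq fun x h₁ h₂ => ?_
      have hdel : x = delL hk ∨ x = delR hk →
          ∃ a b, UCup w a b ∧ skip m k i < a ∧ b < skip m k j ∧ (x = a ∨ x = b) := by
        intro hx
        refine ⟨delL hk, delR hk, .of_delLabels h ?_, ?_, ?_, hx⟩
        · by_contra h0
          rw [Fin.lt_def] at h₁
          rw [val_skip, if_neg (by omega)] at h₁
          rcases hx with rfl | rfl
          · rw [val_delL] at h₁; omega
          · rw [val_delR] at h₁; omega
        · rcases hx with rfl | rfl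
          · exact h₁
          · exact (skip_lt_delR hk).1 h₁
        · rcases hx with rfl | rfl
          · exact (delR_lt_skip hk).2 h₂
          · exact h₂
      obtain rfl | rfl | ⟨x, rfl⟩ := eq_del_or_skip hk x
      · exact hdel (.inl rfl)
      · exact hdel (.inr rfl)
      · rw [skip_lt_skip] at h₁ h₂
        obtain ⟨a, b, hab, ha, hb, hx⟩ := hij.exists_between h₁ h₂
        have hlt : (b : ℕ) - a < d := by
          clear hdel
          omega
        refine ⟨_, _, ih _ hlt hab rfl, skip_lt_skip.2 ha, skip_lt_skip.2 hb,
          ?_⟩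
        rwa [skip_inj, skip_inj]

theorem free_skip_iff (h : DelLabels hk w) {i : Fin m} :
    Free w (skip m k i) ↔ Free (w ∘ skip m k) i := by
  constructor
  · exact fun hf j => ⟨fun hj => (hf _).1 ((uCup_skip_iff h).2 hj),
      fun hj => (hf _).2 ((uCup_skip_iff h).2 hj)⟩
  · refine fun hf x => ⟨fun hx => ?_, fun hx => ?_⟩
    · obtain ⟨-, h', -⟩ | ⟨a, b, ha, rfl⟩ := uCup_cases h hx
      · exact skip_ne_delL hk _ h'
      · exact (hf b).1 ((uCup_skip_iff h).1 hx)
    · obtain ⟨-, -, h'⟩ | ⟨a, b, rfl, hb⟩ := uCup_cases h hx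
      · exact skip_ne_delR hk _ h'
      · exact (hf a).2 ((uCup_skip_iff h).1 hx)

theorem free_del_iff (h : DelLabels hk w) :
    (Free w (delL hk) ↔ k = 0) ∧ (Free w (delR hk) ↔ k = 0) := by
  rcases Nat.eq_zero_or_pos k with h0 | h0
  · refine ⟨iff_of_true (fun x => ?_) h0, iff_of_true (fun x => ?_) h0⟩
    · exact ⟨(not_uCup_of_zero h h0 x).1, (not_uCup_of_zero h h0 x).2.1⟩
    · exact ⟨(not_uCup_of_zero h h0 x).2.2.1, (not_uCup_of_zero h h0 x).2.2.2⟩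
  · exact ⟨iff_of_false (fun hf => (hf _).1 (.of_delLabels h h0)) h0.ne',
      iff_of_false (fun hf => (hf _).2 (.of_delLabels h h0)) h0.ne'⟩

theorem DCup.of_delLabels (h : DelLabels hk w) (h0 : k = 0) : DCup w (delL hk) (delR hk) := by
  refine ⟨delL_lt_delR hk, (free_del_iff h).1.2 h0, (free_del_iff h).2.2 h0, h.left_eq_up h0, h.2,
    fun x h₁ h₂ => (not_between_del hk x ⟨h₁, h₂⟩).elim, ?_⟩
  rw [Finset.card_eq_zero.2]
  · exact Even.zero
  · ext x
    have : ¬ x < delL hk := by rw [Fin.lt_def, val_delL]; omega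
    simp [this]

theorem dCup_cases (h : DelLabels hk w) {x y : Fin (m + 2)} (hxy : DCup w x y) :
    (k = 0 ∧ x = delL hk ∧ y = delR hk) ∨ ∃ i j, x = skip m k i ∧ y = skip m k j := by
  classical
  obtain ⟨hlt, hx, hy, -, -, hb, hev⟩ := hxy
  have hR : k = 0 → ¬ delR hk = x := by
    -- Only the first vertex lies to the left of `delR hk`, so it cannot start a pair.
    rintro h0 rfl
    have : (Finset.univ.filter fun z => z < delR hk ∧ Free w z ∧ w z = up) = {delL hk} := by
      ext z
      simp only [Finset.mem_filter, Finset.mem_univ, true_and, Finset.mem_singleton]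
      constructor
      · rintro ⟨hz, -⟩
        rw [Fin.lt_def, val_delR] at hz
        exact Fin.ext (by rw [val_delL]; omega)
      · rintro rfl
        exact ⟨delL_lt_delR hk, (free_del_iff h).1.2 h0, h.left_eq_up h0⟩
    have h2 : Even ({delL hk} : Finset (Fin (m + 2))).card := by
      rw [← this]; convert hev
    simp at h2
  obtain rfl | rfl | ⟨i, rfl⟩ := eq_del_or_skip hk x
  · have h0 := (free_del_iff h).1.1 hx
    refine .inl ⟨h0, rfl, ?_⟩
    rcases lt_trichotomy y (delR hk) with h' | h' | h'
    · exact (not_between_del hk y ⟨hlt, h'⟩).elim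
    · exact h'
    · exact (hb _ (delL_lt_delR hk) h' ((free_del_iff h).2.2 h0)).elim
  · exact (hR ((free_del_iff h).2.1 hx) rfl).elim
  obtain rfl | rfl | ⟨j, rfl⟩ := eq_del_or_skip hk y
  · have h0 := (free_del_iff h).1.1 hy
    rw [Fin.lt_def, val_delL] at hlt
    omega
  · have h0 := (free_del_iff h).2.1 hy
    have := (skip_lt_delR hk).1 hlt
    rw [Fin.lt_def, val_delL] at this
    omega
  · exact .inr ⟨i, j, rfl, rfl⟩

theorem even_ite_add_ite {P Q : Prop} [Decidable P] [Decidable Q] (h : P ↔ Q) :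
    Even ((if P then 1 else 0) + (if Q then 1 else 0) : ℕ) := by
  simp only [h]
  exact ⟨_, rfl⟩

theorem dCup_skip_iff (h : DelLabels hk w) {i j : Fin m} :
    DCup w (skip m k i) (skip m k j) ↔ DCup (w ∘ skip m k) i j := by
  classical
  unfold DCup
  rw [skip_lt_skip, free_skip_iff h, free_skip_iff h]
  refine and_congr_right fun hij => and_congr_right fun hi => and_congr_right fun _ =>
    and_congr_right fun _ => and_congr_right fun _ => and_congr ?_ ?_
  · constructor
    · exact fun hb x h₁ h₂ hf => hb _ (skip_lt_skip.2 h₁) (skip_lt_skip.2 h₂)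
        ((free_skip_iff h).2 hf)
    · intro hb x h₁ h₂ hf
      obtain rfl | rfl | ⟨x, rfl⟩ := eq_del_or_skip hk x
      · have h0 := (free_del_iff h).1.1 hf
        rw [Fin.lt_def, val_delL] at h₁
        omega
      · have h0 := (free_del_iff h).2.1 hf
        have := (skip_lt_delR hk).1 h₁
        rw [Fin.lt_def, val_delL] at this
        omega
      · exact hb x (skip_lt_skip.1 h₁) (skip_lt_skip.1 h₂) ((free_skip_iff h).1 hf)
  · have key := card_filter_eq_del_add_skip hk fun x => x < skip m k i ∧ Free w x ∧ w x = up
    have hdel : (delL hk < skip m k i ∧ Free w (delL hk) ∧ w (delL hk) = up) ↔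
        (delR hk < skip m k i ∧ Free w (delR hk) ∧ w (delR hk) = up) := by
      rw [delR_lt_skip, (free_del_iff h).1, (free_del_iff h).2, h.1, h.2]
      simp +contextual
    simp only [skip_lt_skip, free_skip_iff h] at key
    have hadd := iff_of_eq (congrArg Even key)
    rw [Nat.even_add] at hadd
    convert hadd.trans (iff_true_left (@even_ite_add_ite _ _ (_) (_) hdel))
    rfl

theorem contractible_iff (hk : k < m + 2) (w : Fin (m + 2) → Bool) :
    Contractible k w ↔ DelLabels hk w := by
  constructor
  · rintro (⟨h0, i, j, hi, hj, hij⟩ | ⟨h0, i, j, hi, hj, hij⟩)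
    · obtain rfl : i = delL hk := Fin.ext (by rw [val_delL]; omega)
      obtain rfl : j = delR hk := Fin.ext (by rw [val_delR]; omega)
      exact ⟨by rw [hij.left_eq, decide_eq_false h0.ne'], hij.right_eq⟩
    · obtain rfl : i = delL hk := Fin.ext (by rw [val_delL]; omega)
      obtain rfl : j = delR hk := Fin.ext (by rw [val_delR]; omega)
      exact ⟨by rw [hij.2.2.2.1, decide_eq_true h0], hij.2.2.2.2.1⟩
  · intro h
    rcases Nat.eq_zero_or_pos k with h0 | h0
    · exact .inr ⟨h0, _, _, by rw [val_delL]; omega, by rw [val_delR]; omega, .of_delLabels h h0⟩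
    · exact .inl ⟨h0, _, _, by rw [val_delL]; omega, by rw [val_delR]; omega, .of_delLabels h h0⟩

end Delete

/-! ### Contraction of weights -/

section Contract

variable {m k : ℕ}

/-- The remaining labels of a weight contractible at `k`, in terms of its contraction `v`: the first
label is switched if `k > 0`. -/
def twist (k : ℕ) (v : Fin m → Bool) : Fin m → Bool := if 0 < k then flipFirst v else v

theorem twist_apply (v : Fin m → Bool) (i : Fin m) :
    twist k v i = if 0 < k ∧ (i : ℕ) = 0 then !v i else v i := by
  unfold twist flipFirst
  by_cases h : 0 < k <;> simp [h]

theorem twist_of_ne (v : Fin m → Bool) {i : Fin m} (hi : (i : ℕ) ≠ 0) : twist k v i = v i := by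
  simp [twist_apply, hi]

@[simp] theorem twist_twist (v : Fin m → Bool) : twist k (twist k v) = v := by
  unfold twist; split_ifs <;> simp

/-- The relation between a label sequence `w` contractible at `k` and its contraction `v`, as an explicit
condition on labels. -/
structure Contracts (hk : k < m + 2) (w : Fin (m + 2) → Bool) (v : Fin m → Bool) : Prop where
  delLabels : DelLabels hk w
  comp_skip : w ∘ skip m k = twist k v

variable {hk : k < m + 2} {w ν : Fin (m + 2) → Bool} {v ν' : Fin m → Bool}

namespace Contracts

theorem apply_skip (h : Contracts hk w v) (i : Fin m) : w (skip m k i) = twist k v i :=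
  congrFun h.comp_skip i

theorem right_unique {v' : Fin m → Bool} (h : Contracts hk w v) (h' : Contracts hk w v') :
    v = v' := by
  rw [← twist_twist (k := k) v, ← h.comp_skip, h'.comp_skip, twist_twist]

theorem left_unique {w' : Fin (m + 2) → Bool} (h : Contracts hk w v) (h' : Contracts hk w' v) :
    w = w' := by
  ext x
  obtain rfl | rfl | ⟨i, rfl⟩ := eq_del_or_skip hk x
  · rw [h.delLabels.1, h'.delLabels.1]
  · rw [h.delLabels.2, h'.delLabels.2]
  · rw [h.apply_skip, h'.apply_skip]

theorem uCup_skip_iff (h : Contracts hk w v) {i j : Fin m} : UCup w (skip m k i) (skip m k j) ↔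
    if 0 < k ∧ (i : ℕ) = 0 then DCup v i j else UCup v i j := by
  rw [ArcD.uCup_skip_iff h.delLabels, h.comp_skip, twist]
  by_cases h0 : 0 < k
  · simp only [h0, if_true, true_and, uCup_flipFirst]
  · simp [h0]

theorem dCup_skip_iff (h : Contracts hk w v) {i j : Fin m} : DCup w (skip m k i) (skip m k j) ↔
    if 0 < k ∧ (i : ℕ) = 0 then UCup v i j else DCup v i j := by
  rw [ArcD.dCup_skip_iff h.delLabels, h.comp_skip, twist]
  by_cases h0 : 0 < k
  · simp only [h0, if_true, true_and, dCup_flipFirst]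
  · simp [h0]

theorem cup_skip_iff (h : Contracts hk w v) {i j : Fin m} :
    Cup w (skip m k i) (skip m k j) ↔ Cup v i j := by
  rw [Cup, Cup, h.uCup_skip_iff, h.dCup_skip_iff]
  split_ifs
  · exact or_comm
  · rfl

theorem cup_cases (h : Contracts hk w v) {x y : Fin (m + 2)} (hxy : Cup w x y) :
    (x = delL hk ∧ y = delR hk) ∨ ∃ i j, x = skip m k i ∧ y = skip m k j ∧ Cup v i j := by
  have key : ((x = delL hk ∧ y = delR hk) ∨ ∃ i j, x = skip m k i ∧ y = skip m k j) := by
    rcases hxy with hxy | hxy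
    · exact (uCup_cases h.delLabels hxy).imp (fun h => h.2) id
    · exact (dCup_cases h.delLabels hxy).imp (fun h => h.2) id
  refine key.imp id ?_
  rintro ⟨i, j, rfl, rfl⟩
  exact ⟨i, j, rfl, rfl, h.cup_skip_iff.1 hxy⟩

theorem cup_del (h : Contracts hk w v) : Cup w (delL hk) (delR hk) := by
  rcases Nat.eq_zero_or_pos k with h0 | h0
  · exact .inr (.of_delLabels h.delLabels h0)
  · exact .inl (.of_delLabels h.delLabels h0)

theorem not_ray_delL (h : Contracts hk w v) : ¬ Ray w (delL hk) := fun hr => (hr _).1 h.cup_del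

theorem not_ray_delR (h : Contracts hk w v) : ¬ Ray w (delR hk) := fun hr => (hr _).2 h.cup_del

theorem cup_skip_left (h : Contracts hk w v) {i : Fin m} {y : Fin (m + 2)}
    (hy : Cup w (skip m k i) y) : ∃ j, y = skip m k j ∧ Cup v i j := by
  obtain ⟨h', -⟩ | ⟨i', j, h', rfl, hij⟩ := h.cup_cases hy
  · exact (skip_ne_delL hk _ h').elim
  · rw [skip_inj] at h'
    exact ⟨j, rfl, h' ▸ hij⟩

theorem cup_skip_right (h : Contracts hk w v) {j : Fin m} {x : Fin (m + 2)}
    (hx : Cup w x (skip m k j)) : ∃ i, x = skip m k i ∧ Cup v i j := by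
  obtain ⟨-, h'⟩ | ⟨i, j', rfl, h', hij⟩ := h.cup_cases hx
  · exact (skip_ne_delR hk _ h').elim
  · rw [skip_inj] at h'
    exact ⟨i, rfl, h' ▸ hij⟩

theorem ray_skip_iff (h : Contracts hk w v) {i : Fin m} : Ray w (skip m k i) ↔ Ray v i := by
  constructor
  · exact fun hr j => ⟨fun hj => (hr _).1 (h.cup_skip_iff.2 hj),
      fun hj => (hr _).2 (h.cup_skip_iff.2 hj)⟩
  · refine fun hr y => ⟨fun hy => ?_, fun hy => ?_⟩
    · obtain ⟨j, -, hj⟩ := h.cup_skip_left hy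
      exact (hr j).1 hj
    · obtain ⟨j, -, hj⟩ := h.cup_skip_right hy
      exact (hr j).2 hj

/-- At a vertex where the first label has been switched, equal and different labels are exchanged. -/
theorem label_eq_iff (h : Contracts hk ν ν') {i j : Fin m} (hij : i < j) :
    ν (skip m k i) = ν (skip m k j) ↔
      if 0 < k ∧ (i : ℕ) = 0 then ν' i ≠ ν' j else ν' i = ν' j := by
  rw [h.apply_skip, h.apply_skip, twist_of_ne ν' (i := j) (by omega), twist_apply]
  split_ifs
  · cases ν' i <;> cases ν' j <;> simp
  · rfl

theorem oriented_iff (h : Contracts hk w v) (hν : Contracts hk ν ν') :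
    Oriented w ν ↔ Oriented v ν' := by
  constructor
  · rintro ⟨hU, hD, hR⟩
    refine ⟨fun i j hij => ?_, fun i j hij => ?_, fun i hi => ?_⟩
    · by_cases hi : 0 < k ∧ (i : ℕ) = 0
      · have := hD _ _ (h.dCup_skip_iff.2 (by rwa [if_pos hi]))
        rwa [hν.label_eq_iff hij.lt, if_pos hi] at this
      · have := hU _ _ (h.uCup_skip_iff.2 (by rwa [if_neg hi]))
        rwa [Ne, hν.label_eq_iff hij.lt, if_neg hi] at this
    · by_cases hi : 0 < k ∧ (i : ℕ) = 0
      · have := hU _ _ (h.uCup_skip_iff.2 (by rwa [if_pos hi]))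
        rwa [Ne, hν.label_eq_iff hij.1, if_pos hi, not_not] at this
      · have := hD _ _ (h.dCup_skip_iff.2 (by rwa [if_neg hi]))
        rwa [hν.label_eq_iff hij.1, if_neg hi] at this
    · have := hR _ (h.ray_skip_iff.2 hi)
      rw [hν.apply_skip, h.apply_skip, twist_apply, twist_apply] at this
      split_ifs at this
      · simpa using this
      · exact this
  · rintro ⟨hU, hD, hR⟩
    refine ⟨fun x y hxy => ?_, fun x y hxy => ?_, fun x hx => ?_⟩
    · obtain ⟨h0, rfl, rfl⟩ | ⟨i, j, rfl, rfl⟩ := uCup_cases h.delLabels hxy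
      · rw [hν.delLabels.1, hν.delLabels.2, decide_eq_false h0.ne']
        simp
      · have hij := skip_lt_skip.1 hxy.lt
        rw [h.uCup_skip_iff] at hxy
        rw [Ne, hν.label_eq_iff hij]
        split_ifs at hxy ⊢
        · rw [not_not]; exact hD _ _ hxy
        · exact hU _ _ hxy
    · obtain ⟨h0, rfl, rfl⟩ | ⟨i, j, rfl, rfl⟩ := dCup_cases h.delLabels hxy
      · rw [hν.delLabels.left_eq_up h0, hν.delLabels.2]
      · have hij := skip_lt_skip.1 hxy.1
        rw [h.dCup_skip_iff] at hxy
        rw [hν.label_eq_iff hij]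
        split_ifs at hxy ⊢
        · exact hU _ _ hxy
        · exact hD _ _ hxy
    · obtain rfl | rfl | ⟨i, rfl⟩ := eq_del_or_skip hk x
      · exact (h.not_ray_delL hx).elim
      · exact (h.not_ray_delR hx).elim
      · rw [hν.apply_skip, h.apply_skip, twist_apply, twist_apply, hR i (h.ray_skip_iff.1 hx)]

/-- The deleted cup has `∧` at its right vertex, so it does not contribute to the degree. -/
theorem cupDegree_eq (h : Contracts hk w v) (hν : Contracts hk ν ν') :
    cupDegree w ν = cupDegree v ν' := by
  classical
  symm
  unfold cupDegree
  refine Finset.card_bij (fun c _ => (skip m k c.1, skip m k c.2)) ?_ ?_ ?_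
  · rintro ⟨i, j⟩ hc
    simp only [Finset.mem_filter, Finset.mem_univ, true_and] at hc ⊢
    have := hc.1.lt
    rw [hν.apply_skip, twist_of_ne _ (by omega)]
    exact ⟨h.cup_skip_iff.2 hc.1, hc.2⟩
  · rintro ⟨i, j⟩ - ⟨i', j'⟩ - hc
    simpa [skip_inj] using hc
  · rintro ⟨x, y⟩ hc
    simp only [Finset.mem_filter, Finset.mem_univ, true_and] at hc
    obtain ⟨hxy, hy⟩ := hc
    obtain ⟨rfl, rfl⟩ | ⟨i, j, rfl, rfl, hij⟩ := h.cup_cases hxy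
    · simp [hν.delLabels.2] at hy
    · have := hij.lt
      rw [hν.apply_skip, twist_of_ne _ (by omega)] at hy
      exact ⟨(i, j), by simp [hij, hy], rfl⟩

end Contracts

theorem fixParity_eq (v : Fin m → Bool) : fixParity v =
    if Even (Finset.univ.filter fun j => v j = up).card then v else flipFirst v := by
  ext i
  unfold fixParity flipFirst
  split_ifs <;> simp_all

theorem even_card_flipFirst (hm : m ≠ 0) (v : Fin m → Bool) :
    Even (Finset.univ.filter fun j => flipFirst v j = up).card ↔
      ¬ Even (Finset.univ.filter fun j => v j = up).card := by
  obtain ⟨m, rfl⟩ := Nat.exists_eq_succ_of_ne_zero hm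
  have h0 : flipFirst v 0 = !v 0 := flipFirst_zero rfl
  have h1 : ∀ i : Fin m, flipFirst v i.succ = v i.succ := fun i => flipFirst_of_ne (by simp)
  rw [Finset.card_filter, Finset.card_filter, Fin.sum_univ_succ, Fin.sum_univ_succ]
  simp only [h0, h1, Nat.even_add]
  cases v 0 <;> simp

theorem card_up_eq (h : DelLabels hk w) : (Finset.univ.filter fun x => w x = up).card =
    (if k = 0 then 2 else 1) + (Finset.univ.filter fun i => w (skip m k i) = up).card := by
  have := card_filter_eq_del_add_skip hk fun x => w x = up
  simp only [h.1, h.2, decide_eq_true_eq] at this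
  rw [show (if k = 0 then 2 else 1) = (if k = 0 then 1 else 0) + if True then 1 else 0 by
    split_ifs <;> rfl]
  convert this

theorem contracts_contract {w : Weight (m + 2)} (h : DelLabels hk w.1) :
    Contracts hk w.1 (contract k w).1 := by
  refine ⟨h, ?_⟩
  have hw := w.2
  rw [card_up_eq h, Nat.even_add] at hw
  simp only [contract, deleteVertices_eq, fixParity_eq, twist]
  rcases Nat.eq_zero_or_pos k with h0 | h0
  · subst h0
    simp only [if_true, even_two, true_iff] at hw
    simp only [lt_irrefl, if_false]
    rw [if_pos]
    exact hw
  · simp only [h0.ne', if_false, Nat.not_even_one, false_iff] at hw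
    rw [if_pos h0, if_neg, flipFirst_flipFirst]
    exact hw

theorem exists_contracts (hmk : m = 0 → k = 0) (v : Weight m) :
    ∃ w : Weight (m + 2), Contracts hk w.1 v.1 := by
  classical
  let w : Fin (m + 2) → Bool := Function.extend (skip m k) (twist k v.1)
    fun x => if x = delL hk then decide (k = 0) else up
  have hw : w ∘ skip m k = twist k v.1 := by
    ext i
    rw [Function.comp_apply, show w = Function.extend _ _ _ from rfl, skip_injective.extend_apply]
  have hdel : DelLabels hk w := by
    constructor
    · rw [show w = Function.extend _ _ _ from rfl, Function.extend_apply', if_pos rfl]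
      rintro ⟨i, hi⟩
      exact skip_ne_delL hk i hi
    · rw [show w = Function.extend _ _ _ from rfl, Function.extend_apply', if_neg]
      · exact (delL_ne_delR hk).symm
      rintro ⟨i, hi⟩
      exact skip_ne_delR hk i hi
  refine ⟨⟨w, ?_⟩, hdel, hw⟩
  rw [card_up_eq hdel, Nat.even_add]
  change _ ↔ Even (Finset.univ.filter fun i => (w ∘ skip m k) i = up).card
  rw [hw, twist]
  have hv := v.2
  split_ifs with h0 h1 h1
  · omega
  · simpa [h0] using hv
  · rw [even_card_flipFirst (fun h => h0 (hmk h))]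
    simpa using hv
  · omega

end Contract

/-! ### Components of stacked diagrams -/

theorem UCup.not_dCup {n : ℕ} {w : Fin n → Bool} {i j : Fin n} (h : UCup w i j) : ¬ DCup w i j :=
  fun h' => (h'.2.1 j).1 h

/-- The tag of a circle is never at the first vertex: there is no cup to its right by maximality of the
tag, and none to its left, so the first vertex would carry a boundary ray. -/
theorem Stacked.IsTag.ne_zero {n : ℕ} {D : Stacked n} {v t : Vertex n} (ht : D.IsTag v t)
    (hv : ¬ D.IsLine v) : (t.1 : ℕ) ≠ 0 := by
  intro h0
  obtain ⟨i, y⟩ := t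
  simp only at h0
  obtain ⟨hconn, hmax⟩ := ht
  have key : ∀ u, (SimpleGraph.fromRel D.Arc).Adj (i, y) u → ¬ i < u.1 := by
    intro u hu hlt
    rcases hmax u (hconn.trans hu.reachable) with h | h
    · exact lt_asymm h hlt
    · exact hlt.ne' h.1
  have hray : ∀ w : Fin n → Bool,
      (∀ j, Cup w i j → (SimpleGraph.fromRel D.Arc).Adj (i, y) (j, y)) → Ray w i := by
    intro w hw j
    refine ⟨fun hj => key _ (hw j hj) hj.lt, fun hj => ?_⟩
    have := hj.lt
    omega
  fin_cases y
  · refine hv (.inl ⟨i, hray _ fun j hj => ?_, hconn⟩)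
    rw [SimpleGraph.fromRel_adj]
    exact ⟨fun h => hj.lt.ne (congrArg Prod.fst h), .inl (.inl ⟨rfl, rfl, hj⟩)⟩
  · refine hv (.inr ⟨i, hray _ fun j hj => ?_, hconn⟩)
    rw [SimpleGraph.fromRel_adj]
    exact ⟨fun h => hj.lt.ne (congrArg Prod.fst h), .inl (.inr (.inl ⟨rfl, rfl, hj⟩))⟩

theorem Reachable.mem_of_closed {V : Type*} {G : SimpleGraph V} {S : Set V}
    (hS : ∀ u v, G.Adj u v → u ∈ S → v ∈ S) {u v : V} (h : G.Reachable u v) (hu : u ∈ S) :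
    v ∈ S := by
  obtain ⟨p⟩ := h
  induction p with
  | nil => exact hu
  | cons hadj _ ih => exact ih (hS _ _ hadj hu)

section Stack

variable {m k : ℕ} {hk : k < m + 2}

/-- The vertex is one of the two deleted ones. -/
def IsDel (hk : k < m + 2) (x : Fin (m + 2)) : Prop := x = delL hk ∨ x = delR hk

theorem not_isDel_skip (i : Fin m) : ¬ IsDel hk (skip m k i) :=
  fun h => h.elim (skip_ne_delL hk i) (skip_ne_delR hk i)

theorem Contracts.isDel_iff {w : Fin (m + 2) → Bool} {v : Fin m → Bool} (h : Contracts hk w v)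
    {x y : Fin (m + 2)} (hxy : Cup w x y) : IsDel hk x ↔ IsDel hk y := by
  obtain ⟨rfl, rfl⟩ | ⟨i, j, rfl, rfl, -⟩ := h.cup_cases hxy
  · exact iff_of_true (.inl rfl) (.inr rfl)
  · exact iff_of_false (not_isDel_skip i) (not_isDel_skip j)

/-- The embedding of the vertices of a stacked diagram that skips the two deleted columns. -/
def skipV (k : ℕ) (v : Vertex m) : Vertex (m + 2) := (skip m k v.1, v.2)

theorem skipV_injective : Function.Injective (skipV (m := m) k) := by
  rintro ⟨i, y⟩ ⟨j, z⟩ h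
  simpa [skipV, skip_inj] using h

theorem exists_skipV (v : Vertex (m + 2)) (hv : ¬ IsDel hk v.1) : ∃ u, v = skipV k u := by
  obtain ⟨x, y⟩ := v
  obtain rfl | rfl | ⟨i, rfl⟩ := eq_del_or_skip hk x
  · exact (hv (.inl rfl)).elim
  · exact (hv (.inr rfl)).elim
  · exact ⟨(i, y), rfl⟩

/-- `D'` is obtained from the stacked diagram `D` by contraction of all three weights. Whether
surgery has already been performed at the deleted cup is left open. -/
structure StackContracts (hk : k < m + 2) (D : Stacked (m + 2)) (D' : Stacked m) : Prop where
  bot : Contracts hk D.bot.1 D'.bot.1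
  mid : Contracts hk D.mid.1 D'.mid.1
  top : Contracts hk D.top.1 D'.top.1
  cut : ∀ i j, (skip m k i, skip m k j) ∈ D.cut ↔ (i, j) ∈ D'.cut

/-- Both weights of the labelling `o` contract to those of `o'`. -/
def LabContracts (hk : k < m + 2) (o : Labelling (m + 2)) (o' : Labelling m) : Prop :=
  ∀ y, Contracts hk (o y).1 (o' y).1

theorem LabContracts.symbolAt_skipV {o : Labelling (m + 2)} {o' : Labelling m}
    (ho : LabContracts hk o o') (v : Vertex m) : symbolAt o (skipV k v) =
      if 0 < k ∧ (v.1 : ℕ) = 0 then !symbolAt o' v else symbolAt o' v := by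
  rw [symbolAt, skipV, (ho _).apply_skip, twist_apply]; rfl

theorem LabContracts.right_unique {o : Labelling (m + 2)} {o₁ o₂ : Labelling m}
    (h₁ : LabContracts hk o o₁) (h₂ : LabContracts hk o o₂) : o₁ = o₂ :=
  funext fun y => Subtype.ext ((h₁ y).right_unique (h₂ y))

theorem LabContracts.left_unique {o₁ o₂ : Labelling (m + 2)} {o : Labelling m}
    (h₁ : LabContracts hk o₁ o) (h₂ : LabContracts hk o₂ o) : o₁ = o₂ :=
  funext fun y => Subtype.ext ((h₁ y).left_unique (h₂ y))

namespace StackContracts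

variable {D : Stacked (m + 2)} {D' : Stacked m} (h : StackContracts hk D D')
include h

theorem surgery (i j : Fin m) :
    StackContracts hk (D.surgery (skip m k i, skip m k j)) (D'.surgery (i, j)) where
  bot := h.bot
  mid := h.mid
  top := h.top
  cut i' j' := by
    simp only [Stacked.surgery, Set.mem_insert_iff, h.cut, Prod.mk.injEq, skip_inj]

theorem surgery_del : StackContracts hk (D.surgery (delL hk, delR hk)) D' where
  bot := h.bot
  mid := h.mid
  top := h.top
  cut i' j' := by
    simp only [Stacked.surgery, Set.mem_insert_iff, h.cut, Prod.mk.injEq, skip_ne_delL, false_and,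
      false_or]

theorem midCup_skip_iff {i j : Fin m} : D.MidCup (skip m k i) (skip m k j) ↔ D'.MidCup i j := by
  rw [Stacked.MidCup, Stacked.MidCup, h.mid.cup_skip_iff, h.cut]

theorem vertical_skip_iff {i : Fin m} : D.Vertical (skip m k i) ↔ D'.Vertical i := by
  constructor
  · exact fun hv j => ⟨fun hj => (hv _).1 (h.midCup_skip_iff.2 hj),
      fun hj => (hv _).2 (h.midCup_skip_iff.2 hj)⟩
  · refine fun hv y => ⟨fun hy => ?_, fun hy => ?_⟩
    · obtain ⟨j, rfl, -⟩ := h.mid.cup_skip_left hy.1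
      exact (hv j).1 (h.midCup_skip_iff.1 hy)
    · obtain ⟨j, rfl, -⟩ := h.mid.cup_skip_right hy.1
      exact (hv j).2 (h.midCup_skip_iff.1 hy)

theorem arc_skipV_iff {u v : Vertex m} : D.Arc (skipV k u) (skipV k v) ↔ D'.Arc u v := by
  simp only [Stacked.Arc, skipV, h.bot.cup_skip_iff, h.top.cup_skip_iff, h.midCup_skip_iff,
    h.vertical_skip_iff, skip_inj]

theorem isDel_iff_of_arc {u v : Vertex (m + 2)} (huv : D.Arc u v) :
    IsDel hk u.1 ↔ IsDel hk v.1 := by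
  rcases huv with ⟨-, -, h'⟩ | ⟨-, -, h'⟩ | ⟨-, h'⟩ | ⟨-, -, h', -⟩
  · exact h.bot.isDel_iff h'
  · exact h.top.isDel_iff h'
  · exact h.mid.isDel_iff h'.1
  · rw [h']

theorem isDel_iff_of_conn {u v : Vertex (m + 2)} (huv : D.Conn u v) :
    IsDel hk u.1 ↔ IsDel hk v.1 := by
  have hadj : ∀ u v, (SimpleGraph.fromRel D.Arc).Adj u v → (IsDel hk u.1 ↔ IsDel hk v.1) := by
    intro u v huv
    rw [SimpleGraph.fromRel_adj] at huv
    exact huv.2.elim h.isDel_iff_of_arc fun h' => (h.isDel_iff_of_arc h').symm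
  have key : ∀ u v, D.Conn u v → IsDel hk u.1 → IsDel hk v.1 := fun u v huv =>
    Reachable.mem_of_closed (S := {v : Vertex (m + 2) | IsDel hk v.1})
      (fun a b hab => (hadj a b hab).1) huv
  exact ⟨key u v huv, key v u huv.symm⟩

theorem exists_of_conn_skipV {u : Vertex m} {v : Vertex (m + 2)} (huv : D.Conn (skipV k u) v) :
    ∃ u', v = skipV k u' :=
  exists_skipV (hk := hk) v fun hv => not_isDel_skip u.1 ((h.isDel_iff_of_conn huv).2 hv)

theorem conn_skipV_iff {u v : Vertex m} : D.Conn (skipV k u) (skipV k v) ↔ D'.Conn u v := by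
  have hadj : ∀ u v, (SimpleGraph.fromRel D.Arc).Adj (skipV k u) (skipV k v) ↔
      (SimpleGraph.fromRel D'.Arc).Adj u v := by
    intro u v
    rw [SimpleGraph.fromRel_adj, SimpleGraph.fromRel_adj, skipV_injective.ne_iff, h.arc_skipV_iff,
      h.arc_skipV_iff]
  constructor
  · intro huv
    have key := Reachable.mem_of_closed (S := {x | ∃ u', x = skipV k u' ∧ D'.Conn u u'}) ?_ huv
      ⟨u, rfl, .rfl⟩
    · obtain ⟨v', hv', huv'⟩ := key
      rwa [skipV_injective hv']
    · rintro a b hab ⟨u', rfl, hu'⟩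
      obtain ⟨v', rfl⟩ := h.exists_of_conn_skipV hab.reachable
      exact ⟨v', rfl, hu'.trans ((hadj _ _).1 hab).reachable⟩
  · intro huv
    exact huv.map ⟨skipV k, fun {a b} hab => (hadj a b).2 hab⟩

theorem meetsSouth_skipV_iff {v : Vertex m} : D.MeetsSouth (skipV k v) ↔ D'.MeetsSouth v := by
  constructor
  · rintro ⟨x, hx, hvx⟩
    obtain ⟨⟨i, y⟩, hu⟩ := h.exists_of_conn_skipV hvx
    obtain ⟨rfl, rfl⟩ := Prod.mk.inj hu
    exact ⟨i, h.bot.ray_skip_iff.1 hx, h.conn_skipV_iff.1 hvx⟩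
  · rintro ⟨i, hi, hvi⟩
    exact ⟨_, h.bot.ray_skip_iff.2 hi, h.conn_skipV_iff.2 hvi⟩

theorem meetsNorth_skipV_iff {v : Vertex m} : D.MeetsNorth (skipV k v) ↔ D'.MeetsNorth v := by
  constructor
  · rintro ⟨x, hx, hvx⟩
    obtain ⟨⟨i, y⟩, hu⟩ := h.exists_of_conn_skipV hvx
    obtain ⟨rfl, rfl⟩ := Prod.mk.inj hu
    exact ⟨i, h.top.ray_skip_iff.1 hx, h.conn_skipV_iff.1 hvx⟩
  · rintro ⟨i, hi, hvi⟩
    exact ⟨_, h.top.ray_skip_iff.2 hi, h.conn_skipV_iff.2 hvi⟩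

theorem isLine_skipV_iff {v : Vertex m} : D.IsLine (skipV k v) ↔ D'.IsLine v :=
  or_congr h.meetsSouth_skipV_iff h.meetsNorth_skipV_iff

theorem isPropagating_skipV_iff {v : Vertex m} :
    D.IsPropagating (skipV k v) ↔ D'.IsPropagating v :=
  and_congr h.meetsSouth_skipV_iff h.meetsNorth_skipV_iff

theorem isTag_skipV_iff {v t : Vertex m} : D.IsTag (skipV k v) (skipV k t) ↔ D'.IsTag v t := by
  have hord : ∀ u : Vertex m, ((skipV k u).1 < (skipV k t).1 ∨
      ((skipV k u).1 = (skipV k t).1 ∧ (skipV k u).2 ≤ (skipV k t).2)) ↔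
      (u.1 < t.1 ∨ (u.1 = t.1 ∧ u.2 ≤ t.2)) := fun u => by
    simp only [skipV, skip_lt_skip, skip_inj]
  refine and_congr h.conn_skipV_iff ⟨fun ht u hu => ?_, fun ht x hx => ?_⟩
  · exact (hord u).1 (ht _ (h.conn_skipV_iff.2 hu))
  · obtain ⟨u, rfl⟩ := h.exists_of_conn_skipV hx
    exact (hord u).2 (ht _ (h.conn_skipV_iff.1 hx))

variable {o o₁ : Labelling (m + 2)} {o' o₁' : Labelling m}

theorem clockwise_skipV_iff (ho : LabContracts hk o o') {v : Vertex m} :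
    D.Clockwise o (skipV k v) ↔ D'.Clockwise o' v := by
  unfold Stacked.Clockwise
  rw [h.isLine_skipV_iff]
  refine and_congr_right fun hline => ⟨?_, ?_⟩
  · rintro ⟨x, hx, hox⟩
    obtain ⟨t, rfl⟩ := h.exists_of_conn_skipV hx.1
    rw [h.isTag_skipV_iff] at hx
    refine ⟨t, hx, ?_⟩
    rwa [ho.symbolAt_skipV, if_neg fun h0 => hx.ne_zero hline h0.2] at hox
  · rintro ⟨t, ht, hot⟩
    refine ⟨_, h.isTag_skipV_iff.2 ht, ?_⟩
    rwa [ho.symbolAt_skipV, if_neg fun h0 => ht.ne_zero hline h0.2]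

theorem sign_skipV (ho : LabContracts hk o o') (v : Vertex m) : D.sign o (skipV k v) =
    (if 0 < k ∧ (v.1 : ℕ) = 0 then -1 else 1) * D'.sign o' v := by
  unfold Stacked.sign
  rw [h.clockwise_skipV_iff ho, ho.symbolAt_skipV]
  by_cases hc : D'.Clockwise o' v <;> by_cases h0 : 0 < k ∧ (v.1 : ℕ) = 0 <;>
    cases symbolAt o' v <;> simp [hc, h0]

/-- Where the first label is switched, both signs change, which leaves their product. -/
theorem sign_mul_sign_skipV {E : Stacked (m + 2)} {E' : Stacked m} (hE : StackContracts hk E E')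
    (ho : LabContracts hk o o') (ho₁ : LabContracts hk o₁ o₁') (v : Vertex m) :
    D.sign o (skipV k v) * E.sign o₁ (skipV k v) = D'.sign o' v * E'.sign o₁' v := by
  rw [h.sign_skipV ho, hE.sign_skipV ho₁]
  split_ifs <;> ring

theorem sign_skipV_of_ne (ho : LabContracts hk o o') {v : Vertex m} (hv : (v.1 : ℕ) ≠ 0) :
    D.sign o (skipV k v) = D'.sign o' v := by
  rw [h.sign_skipV ho, if_neg fun h' => hv h'.2, one_mul]

theorem agreeOff_skipV_iff (ho : LabContracts hk o o') (ho₁ : LabContracts hk o₁ o₁')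
    {u v : Vertex m} : D.AgreeOff (skipV k u) (skipV k v) o o₁ ↔ D'.AgreeOff u v o' o₁' := by
  have hsym : ∀ x : Vertex m, symbolAt o (skipV k x) = symbolAt o₁ (skipV k x) ↔
      symbolAt o' x = symbolAt o₁' x := fun x => by
    rw [ho.symbolAt_skipV, ho₁.symbolAt_skipV]
    split_ifs <;> simp
  constructor
  · intro ha x hux hvx
    exact (hsym x).1 (ha _ (h.conn_skipV_iff.not.2 hux) (h.conn_skipV_iff.not.2 hvx))
  · intro ha x hux hvx
    obtain ⟨x, y⟩ := x
    obtain rfl | rfl | ⟨i, rfl⟩ := eq_del_or_skip hk x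
    · exact ((ho y).delLabels.1).trans ((ho₁ y).delLabels.1).symm
    · exact ((ho y).delLabels.2).trans ((ho₁ y).delLabels.2).symm
    · exact (hsym (i, y)).2 (ha (i, y) (h.conn_skipV_iff.not.1 hux) (h.conn_skipV_iff.not.1 hvx))

theorem isOrientation_iff (ho : LabContracts hk o o') :
    D.IsOrientation o ↔ D'.IsOrientation o' := by
  unfold Stacked.IsOrientation
  rw [h.bot.oriented_iff (ho 0), h.top.oriented_iff (ho 1)]
  refine and_congr_right fun _ => and_congr_right fun _ => ?_
  have hlab : ∀ {i j : Fin m} (y : Fin 2), i < j →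
      (symbolAt o (skip m k i, y) = symbolAt o (skip m k j, y) ↔
        if 0 < k ∧ (i : ℕ) = 0 then symbolAt o' (i, y) ≠ symbolAt o' (j, y)
        else symbolAt o' (i, y) = symbolAt o' (j, y)) := fun y hij => (ho y).label_eq_iff hij
  have hvert : ∀ i, symbolAt o (skip m k i, 0) = symbolAt o (skip m k i, 1) ↔
      symbolAt o' (i, 0) = symbolAt o' (i, 1) := fun i => by
    have h0 := ho.symbolAt_skipV (i, 0)
    have h1 := ho.symbolAt_skipV (i, 1)
    simp only [skipV] at h0 h1
    rw [h0, h1]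
    split_ifs <;> simp
  constructor
  · rintro ⟨hU, hD, hV⟩
    refine ⟨fun i j y hij hc => ?_, fun i j y hij hc => ?_, fun i hi => ?_⟩
    · by_cases hi : 0 < k ∧ (i : ℕ) = 0
      · have := hD _ _ y (h.midCup_skip_iff.2 hij) (h.mid.dCup_skip_iff.2 (by rwa [if_pos hi]))
        rwa [hlab y hc.lt, if_pos hi] at this
      · have := hU _ _ y (h.midCup_skip_iff.2 hij) (h.mid.uCup_skip_iff.2 (by rwa [if_neg hi]))
        rwa [Ne, hlab y hc.lt, if_neg hi] at this
    · by_cases hi : 0 < k ∧ (i : ℕ) = 0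
      · have := hU _ _ y (h.midCup_skip_iff.2 hij) (h.mid.uCup_skip_iff.2 (by rwa [if_pos hi]))
        rwa [Ne, hlab y hc.1, if_pos hi, not_not] at this
      · have := hD _ _ y (h.midCup_skip_iff.2 hij) (h.mid.dCup_skip_iff.2 (by rwa [if_neg hi]))
        rwa [hlab y hc.1, if_neg hi] at this
    · exact (hvert i).1 (hV _ (h.vertical_skip_iff.2 hi))
  · rintro ⟨hU, hD, hV⟩
    refine ⟨fun x z y hxz hc => ?_, fun x z y hxz hc => ?_, fun x hx => ?_⟩
    · obtain ⟨h0, rfl, rfl⟩ | ⟨i, j, rfl, rfl⟩ := uCup_cases h.mid.delLabels hc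
      · change (o y).1 _ ≠ (o y).1 _
        rw [(ho y).delLabels.1, (ho y).delLabels.2, decide_eq_false h0.ne']
        simp
      · have hij := skip_lt_skip.1 hc.lt
        rw [h.mid.uCup_skip_iff] at hc
        rw [Ne, hlab y hij]
        rw [h.midCup_skip_iff] at hxz
        split_ifs at hc ⊢
        · rw [not_not]; exact hD _ _ y hxz hc
        · exact hU _ _ y hxz hc
    · obtain ⟨h0, rfl, rfl⟩ | ⟨i, j, rfl, rfl⟩ := dCup_cases h.mid.delLabels hc
      · change (o y).1 _ = (o y).1 _
        rw [(ho y).delLabels.left_eq_up h0, (ho y).delLabels.2]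
      · have hij := skip_lt_skip.1 hc.1
        rw [h.mid.dCup_skip_iff] at hc
        rw [hlab y hij]
        rw [h.midCup_skip_iff] at hxz
        split_ifs at hc ⊢
        · exact hU _ _ y hxz hc
        · exact hD _ _ y hxz hc
    · obtain rfl | rfl | ⟨i, rfl⟩ := eq_del_or_skip hk x
      · exact ((ho 0).delLabels.1).trans ((ho 1).delLabels.1).symm
      · exact ((ho 0).delLabels.2).trans ((ho 1).delLabels.2).symm
      · exact (hvert i).2 (hV i (h.vertical_skip_iff.1 hx))

end StackContracts

end Stack

/-! ### Coefficients of a surgery away from the deleted vertices -/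

section Coeff

variable {m k : ℕ} {hk : k < m + 2}

theorem neg_one_pow_skip (i : Fin m) : (-1 : ℤ) ^ (skip m k i : ℕ) = (-1) ^ (i : ℕ) := by
  rw [val_skip]
  split_ifs
  · rfl
  · rw [pow_add]; simp

namespace StackContracts

variable {D : Stacked (m + 2)} {D' : Stacked m} (h : StackContracts hk D D')
  {o o₁ : Labelling (m + 2)} {o' o₁' : Labelling m}
include h

open Classical in
theorem mergeCoeff_eq {E : Stacked (m + 2)} {E' : Stacked m} (hE : StackContracts hk E E')
    (ho : LabContracts hk o o') (ho₁ : LabContracts hk o₁ o₁') (i : Fin m) :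
    Stacked.mergeCoeff D E (skip m k i) o o₁ = Stacked.mergeCoeff D' E' i o' o₁' := by
  unfold Stacked.mergeCoeff
  have hv : ∀ y : Fin 2, (skip m k i, y) = skipV k (i, y) := fun _ => rfl
  simp only [hv, hE.agreeOff_skipV_iff ho ho₁, h.clockwise_skipV_iff ho, hE.clockwise_skipV_iff ho₁,
    h.sign_mul_sign_skipV hE ho ho₁]

open Classical in
theorem splitCoeff_eq {E : Stacked (m + 2)} {E' : Stacked m} (hE : StackContracts hk E E')
    (ho : LabContracts hk o o') (ho₁ : LabContracts hk o₁ o₁') {i j : Fin m}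
    (hij : Cup D'.mid.1 i j) :
    Stacked.splitCoeff D E (skip m k i) (skip m k j) o o₁ =
      Stacked.splitCoeff D' E' i j o' o₁' := by
  have hj : ((j, (1 : Fin 2)).1 : ℕ) ≠ 0 := by have := hij.lt; simp only; omega
  -- At the first vertex, the decoration of the cup and the sign at its left end change together.
  have hdec : (if DCup D.mid.1 (skip m k i) (skip m k j) then (1 : ℤ) else -1) *
      E.sign o₁ (skipV k (i, 1)) =
      (if DCup D'.mid.1 i j then 1 else -1) * E'.sign o₁' (i, 1) := by
    rw [hE.sign_skipV ho₁, h.mid.dCup_skip_iff]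
    by_cases h0 : 0 < k ∧ (i : ℕ) = 0
    · rcases hij with hU | hD
      · simp [h0, hU, hU.not_dCup]
      · have : ¬ UCup D'.mid.1 i j := fun hU => hU.not_dCup hD
        simp [h0, hD, this]
    · simp [h0]
  unfold Stacked.splitCoeff
  have hv : ∀ (i : Fin m) (y : Fin 2), (skip m k i, y) = skipV k (i, y) := fun _ _ => rfl
  simp only [hv, hE.agreeOff_skipV_iff ho ho₁, h.clockwise_skipV_iff ho, hE.clockwise_skipV_iff ho₁,
    h.sign_mul_sign_skipV hE ho ho₁, neg_one_pow_skip, mul_assoc, hdec,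
    hE.sign_skipV_of_ne ho₁ hj]

open Classical in
theorem reconnectCoeff_eq (ho : LabContracts hk o o') (ho₁ : LabContracts hk o₁ o₁') (i : Fin m) :
    Stacked.reconnectCoeff D (skip m k i) o o₁ = Stacked.reconnectCoeff D' i o' o₁' := by
  unfold Stacked.reconnectCoeff
  have hv : ∀ y : Fin 2, (skip m k i, y) = skipV k (i, y) := fun _ => rfl
  have heq : o₁ = o ↔ o₁' = o' := by
    constructor
    · rintro rfl; exact ho₁.right_unique ho
    · rintro rfl; exact ho₁.left_unique ho
  simp only [hv, h.isPropagating_skipV_iff, heq]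

open Classical in
theorem coeff_eq (ho : LabContracts hk o o') (ho₁ : LabContracts hk o₁ o₁') {i j : Fin m}
    (hij : Cup D'.mid.1 i j) :
    D.coeff (skip m k i, skip m k j) o o₁ = D'.coeff (i, j) o' o₁' := by
  have hE := h.surgery i j
  unfold Stacked.coeff
  simp only [hE.isOrientation_iff ho₁, h.mergeCoeff_eq hE ho ho₁, h.splitCoeff_eq hE ho ho₁ hij,
    h.reconnectCoeff_eq ho ho₁]
  have hv : ∀ (i : Fin m) (y : Fin 2), (skip m k i, y) = skipV k (i, y) := fun _ _ => rfl
  simp only [hv, h.conn_skipV_iff, hE.conn_skipV_iff]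

end StackContracts

/-- A surgery keeps the orientation outside the components of the ends of the cup. -/
theorem Stacked.symbolAt_eq_of_coeff_ne_zero {n : ℕ} {D : Stacked n} {s : Fin n × Fin n}
    {o o₁ : Labelling n} (hc : D.coeff s o o₁ ≠ 0) {x : Vertex n}
    (hl : ∀ y, ¬ (D.surgery s).Conn (s.1, y) x) (hr : ∀ y, ¬ (D.surgery s).Conn (s.2, y) x) :
    symbolAt o x = symbolAt o₁ x := by
  unfold Stacked.coeff at hc
  split_ifs at hc with h1 h2 h3 h4
  · unfold Stacked.mergeCoeff at hc
    by_cases ha : (D.surgery s).AgreeOff (s.1, 0) (s.1, 1) o o₁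
    · exact ha x (hl 0) (hl 1)
    · exact (hc (if_neg ha)).elim
  · unfold Stacked.splitCoeff at hc
    by_cases ha : (D.surgery s).AgreeOff (s.1, 1) (s.2, 1) o o₁
    · exact ha x (hl 1) (hr 1)
    · exact (hc (if_neg ha)).elim
  · unfold Stacked.reconnectCoeff at hc
    by_cases ha : o₁ = o
    · rw [ha]
    · exact (hc (if_neg fun h => ha h.1)).elim
  · exact (hc rfl).elim
  · exact (hc rfl).elim

theorem Stacked.isOrientation_of_coeff_ne_zero {n : ℕ} {D : Stacked n} {s : Fin n × Fin n}
    {o o₁ : Labelling n} (hc : D.coeff s o o₁ ≠ 0) : (D.surgery s).IsOrientation o₁ := by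
  by_contra h1
  exact hc (if_neg h1)

theorem exists_labContracts {o : Labelling (m + 2)} (ho : ∀ y, DelLabels hk (o y).1) :
    ∃ o', LabContracts hk o o' :=
  ⟨fun y => contract k (o y), fun y => contracts_contract (ho y)⟩

/-- Surgery away from the deleted cup does not change the labels of the deleted vertices. -/
theorem StackContracts.exists_labContracts_of_coeff_ne_zero {D : Stacked (m + 2)} {D' : Stacked m}
    (h : StackContracts hk D D') {o o₁ : Labelling (m + 2)} {o' : Labelling m}
    (ho : LabContracts hk o o') {i j : Fin m}
    (hc : D.coeff (skip m k i, skip m k j) o o₁ ≠ 0) : ∃ o₁', LabContracts hk o₁ o₁' := by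
  refine exists_labContracts fun y => ?_
  have hE := h.surgery i j
  have key : ∀ x, IsDel hk x → (o y).1 x = (o₁ y).1 x := fun x hx => by
    refine Stacked.symbolAt_eq_of_coeff_ne_zero (x := (x, y)) hc (fun z hz => ?_) fun z hz => ?_
    · exact not_isDel_skip i ((hE.isDel_iff_of_conn hz).2 hx)
    · exact not_isDel_skip j ((hE.isDel_iff_of_conn hz).2 hx)
  exact ⟨(key _ (.inl rfl)).symm.trans (ho y).delLabels.1,
    (key _ (.inr rfl)).symm.trans (ho y).delLabels.2⟩

end Coeff

/-! ### Surgery at the deleted cup -/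

section DelCup

variable {m k : ℕ} {hk : k < m + 2} {D : Stacked (m + 2)} {D' : Stacked m}
  {o o₁ : Labelling (m + 2)} {o' : Labelling m}

namespace StackContracts

variable (h : StackContracts hk D D')
include h

theorem conn_delL_delR (y : Fin 2) : D.Conn (delL hk, y) (delR hk, y) := by
  refine SimpleGraph.Adj.reachable ?_
  rw [SimpleGraph.fromRel_adj]
  refine ⟨fun h' => delL_ne_delR hk (congrArg Prod.fst h'), .inl ?_⟩
  fin_cases y
  · exact .inl ⟨rfl, rfl, h.bot.cup_del⟩
  · exact .inr (.inl ⟨rfl, rfl, h.top.cup_del⟩)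

/-- Before the surgery at the deleted cup, the deleted vertices form one circle on each level. -/
theorem not_conn_delL (hcut : (delL hk, delR hk) ∉ D.cut) :
    ¬ D.Conn (delL hk, 0) (delL hk, 1) := by
  intro hconn
  have hmid : D.MidCup (delL hk) (delR hk) := ⟨h.mid.cup_del, hcut⟩
  have hvert : ∀ x, IsDel hk x → ¬ D.Vertical x := by
    rintro x (rfl | rfl) hv
    · exact (hv _).1 hmid
    · exact (hv _).2 hmid
  have harc : ∀ u v, D.Arc u v → IsDel hk u.1 → u.2 = v.2 := by
    rintro u v (⟨hu, hv, -⟩ | ⟨hu, hv, -⟩ | ⟨huv, -⟩ | ⟨-, -, -, hv⟩) hdel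
    · rw [hu, hv]
    · rw [hu, hv]
    · exact huv
    · exact (hvert _ hdel hv).elim
  have := Reachable.mem_of_closed (S := {v : Vertex (m + 2) | IsDel hk v.1 ∧ v.2 = 0}) ?_ hconn
    ⟨.inl rfl, rfl⟩
  · exact absurd this.2 (one_ne_zero (α := Fin 2))
  · rintro u v huv ⟨hu, hu0⟩
    have hv : IsDel hk v.1 := (h.isDel_iff_of_conn huv.reachable).1 hu
    rw [SimpleGraph.fromRel_adj] at huv
    refine ⟨hv, ?_⟩
    rcases huv.2 with huv | huv
    · rw [← harc _ _ huv hu, hu0]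
    · rw [harc _ _ huv hv, hu0]

theorem not_isLine_del (y : Fin 2) : ¬ D.IsLine (delL hk, y) := by
  rintro (⟨x, hx, hc⟩ | ⟨x, hx, hc⟩)
  · obtain rfl | rfl := (h.isDel_iff_of_conn hc).1 (.inl rfl)
    · exact h.bot.not_ray_delL hx
    · exact h.bot.not_ray_delR hx
  · obtain rfl | rfl := (h.isDel_iff_of_conn hc).1 (.inl rfl)
    · exact h.top.not_ray_delL hx
    · exact h.top.not_ray_delR hx

/-- The tag of a circle on the deleted vertices lies in the right column, where a contractible label
sequence has the label `∧`. -/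
theorem not_clockwise_del (ho : LabContracts hk o o') (y : Fin 2) :
    ¬ D.Clockwise o (delL hk, y) := by
  rintro ⟨-, ⟨x, z⟩, ⟨hc, hmax⟩, hx⟩
  have hle := hmax _ (h.conn_delL_delR y)
  obtain rfl | rfl : IsDel hk x := (h.isDel_iff_of_conn hc).1 (.inl rfl)
  · rcases hle with h' | h'
    · exact lt_asymm h' (delL_lt_delR hk)
    · exact delL_ne_delR hk h'.1.symm
  · have := (ho z).delLabels.2
    change (o z).1 _ = down at hx
    simp [hx] at this

end StackContracts

/-- The surgery at the deleted cup merges two anticlockwise circles, so it keeps the orientation. -/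
theorem StackContracts.coeff_del (h : StackContracts hk D D') (hcut : (delL hk, delR hk) ∉ D.cut)
    (ho : LabContracts hk o o') (hor : D.IsOrientation o) :
    D.coeff (delL hk, delR hk) o o₁ = if o₁ = o then 1 else 0 := by
  have hE := h.surgery_del
  have hconn : ¬ D.Conn (delL hk, 0) (delL hk, 1) ∧
      (D.surgery (delL hk, delR hk)).Conn (delL hk, 0) (delR hk, 0) :=
    ⟨h.not_conn_delL hcut, hE.conn_delL_delR 0⟩
  split_ifs with heq
  · subst heq
    have hor' : (D.surgery (delL hk, delR hk)).IsOrientation o₁ := by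
      rwa [hE.isOrientation_iff ho, ← h.isOrientation_iff ho]
    rw [Stacked.coeff, if_pos hor', if_pos hconn, Stacked.mergeCoeff,
      if_pos (show Stacked.AgreeOff _ _ _ _ _ from fun _ _ _ => rfl),
      if_pos ⟨h.not_clockwise_del ho 0, h.not_clockwise_del ho 1⟩,
      if_pos (hE.not_clockwise_del ho 0)]
  · by_contra hne
    have hor₁ := Stacked.isOrientation_of_coeff_ne_zero hne
    rw [Stacked.coeff, if_pos hor₁, if_pos hconn, Stacked.mergeCoeff] at hne
    by_cases ha : (D.surgery (delL hk, delR hk)).AgreeOff (delL hk, 0) (delL hk, 1) o o₁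
    swap
    · exact hne (if_neg ha)
    rw [if_pos ha, if_pos ⟨h.not_clockwise_del ho 0, h.not_clockwise_del ho 1⟩] at hne
    by_cases hcw : (D.surgery (delL hk, delR hk)).Clockwise o₁ (delL hk, 0)
    · exact hne (if_neg (not_not.2 hcw))
    -- The tag of the merged circle is the upper right vertex, so it has the label `∧`, and this
    -- determines the other labels of the circle.
    have hvert : ∀ x, IsDel hk x → (D.surgery (delL hk, delR hk)).Vertical x := by
      have key : ∀ x y, IsDel hk x ∨ IsDel hk y →
          ¬ (D.surgery (delL hk, delR hk)).MidCup x y := by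
        rintro x y hxy ⟨hc, hcut'⟩
        obtain ⟨rfl, rfl⟩ | ⟨i, j, rfl, rfl, -⟩ := hE.mid.cup_cases hc
        · exact hcut' (Set.mem_insert _ _)
        · exact hxy.elim (not_isDel_skip i) (not_isDel_skip j)
      exact fun x hx y => ⟨key x y (.inl hx), key y x (.inr hx)⟩
    obtain ⟨hbot, htop, -, -, hver⟩ := hor₁
    have hR : (o₁ 0).1 (delR hk) = (o₁ 1).1 (delR hk) := hver _ (hvert _ (.inr rfl))
    have hL : (o₁ 0).1 (delL hk) = (o₁ 1).1 (delL hk) := hver _ (hvert _ (.inl rfl))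
    have hR1 : (o₁ 1).1 (delR hk) = up := by
      by_contra hdown
      refine hcw ⟨hE.not_isLine_del 0, (delR hk, 1), ⟨?_, fun u hu => ?_⟩,
        Bool.eq_false_of_not_eq_true hdown⟩
      · refine (hE.conn_delL_delR 0).trans (SimpleGraph.Adj.reachable ?_)
        rw [SimpleGraph.fromRel_adj]
        exact ⟨by simp, .inl (.inr (.inr (.inr ⟨rfl, rfl, rfl, hvert _ (.inr rfl)⟩)))⟩
      · obtain hu | hu : IsDel hk u.1 := (hE.isDel_iff_of_conn hu).1 (.inl rfl)
        · exact .inl (hu ▸ delL_lt_delR hk)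
        · exact .inr ⟨hu, Fin.le_last _⟩
    have hL0 : (o₁ 0).1 (delL hk) = decide (k = 0) := by
      rcases Nat.eq_zero_or_pos k with h0 | h0
      · rw [hbot.2.1 _ _ (.of_delLabels h.bot.delLabels h0), hR, hR1, decide_eq_true h0]
      · have := hbot.1 _ _ (.of_delLabels h.bot.delLabels h0)
        rw [hR, hR1] at this
        rw [decide_eq_false h0.ne']
        simpa using this
    have hdel : ∀ y, DelLabels hk (o₁ y).1 := by
      intro y
      fin_cases y
      · exact ⟨hL0, hR.trans hR1⟩
      · exact ⟨hL.symm.trans hL0, hR1⟩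
    refine heq (funext fun y => Subtype.ext (funext fun x => ?_))
    by_cases hx : IsDel hk x
    · rcases hx with rfl | rfl
      · rw [(hdel y).1, (ho y).delLabels.1]
      · rw [(hdel y).2, (ho y).delLabels.2]
    · have hnc : ∀ z, ¬ (D.surgery (delL hk, delR hk)).Conn (delL hk, z) (x, y) := fun z hc =>
        hx ((hE.isDel_iff_of_conn hc).1 (.inl rfl))
      exact (ha (x, y) (hnc 0) (hnc 1)).symm

end DelCup

/-! ### Iterated surgery -/

section Iterate

variable {m k : ℕ} {hk : k < m + 2}

/-- The preimage of a weight under the contraction. -/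
noncomputable def expand (hk : k < m + 2) (hmk : m = 0 → k = 0) (v : Weight m) : Weight (m + 2) :=
  (exists_contracts (hk := hk) hmk v).choose

theorem contracts_expand (hmk : m = 0 → k = 0) (v : Weight m) :
    Contracts hk (expand hk hmk v).1 v.1 :=
  (exists_contracts hmk v).choose_spec

theorem expand_injective (hmk : m = 0 → k = 0) : Function.Injective (expand hk hmk) := by
  intro v v' h
  have := contracts_expand (hk := hk) hmk v'
  rw [← h] at this
  exact Subtype.ext ((contracts_expand hmk v).right_unique this)

theorem Contracts.eq_expand {w : Weight (m + 2)} {v : Weight m} (h : Contracts hk w.1 v.1)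
    (hmk : m = 0 → k = 0) : w = expand hk hmk v :=
  Subtype.ext (h.left_unique (contracts_expand hmk v))

/-- The list `L` of cups for `D` corresponds to the list `L'` of cups of `μ`. The flag
says whether `L` contains the deleted cup, which then occurs exactly once. -/
inductive ListContracts (hk : k < m + 2) (μ : Weight m) :
    Bool → List (Fin (m + 2) × Fin (m + 2)) → List (Fin m × Fin m) → Prop
  | nil : ListContracts hk μ false [] []
  | skip (b : Bool) (i j : Fin m) (L : List (Fin (m + 2) × Fin (m + 2)))
      (L' : List (Fin m × Fin m)) (hij : Cup μ.1 i j) (h : ListContracts hk μ b L L') :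
      ListContracts hk μ b ((skip m k i, skip m k j) :: L) ((i, j) :: L')
  | del (L : List (Fin (m + 2) × Fin (m + 2))) (L' : List (Fin m × Fin m))
      (h : ListContracts hk μ false L L') :
      ListContracts hk μ true ((delL hk, delR hk) :: L) L'

/-- From a contractible orientation, iterated surgery reaches contractible labellings only, with the
coefficients of the contracted diagram. -/
theorem ListContracts.iterCoeff_eq {μ : Weight m} {b : Bool}
    {L : List (Fin (m + 2) × Fin (m + 2))} {L' : List (Fin m × Fin m)}
    (hL : ListContracts hk μ b L L') (hmk : m = 0 → k = 0) {D : Stacked (m + 2)} {D' : Stacked m}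
    (h : StackContracts hk D D') (hμ : D'.mid = μ) (hcut : b = true → (delL hk, delR hk) ∉ D.cut)
    {o : Labelling (m + 2)} {o' : Labelling m} (ho : LabContracts hk o o')
    (hor : D.IsOrientation o) :
    (∀ σ σ', LabContracts hk σ σ' →
      Stacked.iterCoeff L D o σ = Stacked.iterCoeff L' D' o' σ') ∧
    ∀ σ, (¬ ∃ σ', LabContracts hk σ σ') → Stacked.iterCoeff L D o σ = 0 := by
  induction hL generalizing D D' o o' with
  | nil =>
    refine ⟨fun σ σ' hσ => ?_, fun σ hσ => ?_⟩
    · have heq : o = σ ↔ o' = σ' := by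
        constructor
        · rintro rfl; exact ho.right_unique hσ
        · rintro rfl; exact ho.left_unique hσ
      simp only [Stacked.iterCoeff]
      by_cases h' : o' = σ'
      · rw [if_pos h', if_pos (heq.2 h')]
      · rw [if_neg h', if_neg (heq.not.2 h')]
    · rw [Stacked.iterCoeff, if_neg]
      rintro rfl
      exact hσ ⟨o', ho⟩
  | skip b i j L L' hij hL ih =>
    subst hμ
    have hE := h.surgery i j
    have hcut' : b = true →
        (delL hk, delR hk) ∉ (D.surgery (ArcD.skip m k i, ArcD.skip m k j)).cut := by
      intro hb hmem
      simp only [Stacked.surgery, Set.mem_insert_iff, Prod.mk.injEq] at hmem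
      exact hmem.elim (fun h' => skip_ne_delL hk i h'.1.symm) (hcut hb)
    refine ⟨fun σ σ' hσ => ?_, fun σ hσ => ?_⟩
    · simp only [Stacked.iterCoeff]
      -- Only the labellings that extend a labelling of the contracted diagram contribute.
      let e : Labelling m → Labelling (m + 2) := fun o' y => expand hk hmk (o' y)
      have he : ∀ o', LabContracts hk (e o') o' := fun o' y => contracts_expand hmk (o' y)
      symm
      refine Fintype.sum_of_injective e ?_ _ _ ?_ ?_
      · exact fun o₁ o₂ h₁₂ => (he o₁).right_unique (h₁₂ ▸ he o₂)
      · intro o₁ ho₁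
        by_contra hne
        obtain ⟨o₁', ho₁'⟩ := h.exists_labContracts_of_coeff_ne_zero ho (left_ne_zero_of_mul hne)
        exact ho₁ ⟨o₁', (he o₁').left_unique ho₁'⟩
      · intro o₁'
        rw [h.coeff_eq ho (he o₁') hij]
        by_cases hc : D'.coeff (i, j) o' o₁' = 0
        · rw [hc, zero_mul, zero_mul]
        · have hor₁ := (hE.isOrientation_iff (he o₁')).2 (Stacked.isOrientation_of_coeff_ne_zero hc)
          rw [(ih hE rfl hcut' (he o₁') hor₁).1 σ σ' hσ]
    · simp only [Stacked.iterCoeff]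
      refine Finset.sum_eq_zero fun o₁ _ => ?_
      by_cases hc : D.coeff (ArcD.skip m k i, ArcD.skip m k j) o o₁ = 0
      · rw [hc, zero_mul]
      · obtain ⟨o₁', ho₁⟩ := h.exists_labContracts_of_coeff_ne_zero ho hc
        rw [(ih hE rfl hcut' ho₁ (Stacked.isOrientation_of_coeff_ne_zero hc)).2 σ hσ, mul_zero]
  | del L L' hL ih =>
    have hE := h.surgery_del
    have hor' : (D.surgery (delL hk, delR hk)).IsOrientation o := by
      rwa [hE.isOrientation_iff ho, ← h.isOrientation_iff ho]
    have hsum : ∀ σ, Stacked.iterCoeff ((delL hk, delR hk) :: L) D o σ =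
        Stacked.iterCoeff L (D.surgery (delL hk, delR hk)) o σ := by
      intro σ
      simp only [Stacked.iterCoeff, h.coeff_del (hcut rfl) ho hor]
      rw [Finset.sum_eq_single o (fun o₁ _ hne => by rw [if_neg hne, zero_mul])
        (fun hne => (hne (Finset.mem_univ o)).elim), if_pos rfl, one_mul]
    simp only [hsum]
    exact ih hE hμ (by simp) ho hor'

theorem ListContracts.append_map {μ : Weight m} {b : Bool}
    {L : List (Fin (m + 2) × Fin (m + 2))} {L' : List (Fin m × Fin m)}
    (hL : ListContracts hk μ b L L') (A : List (Fin m × Fin m)) (hA : ∀ s ∈ A, Cup μ.1 s.1 s.2) :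
    ListContracts hk μ b (A.map (Prod.map (ArcD.skip m k) (ArcD.skip m k)) ++ L) (A ++ L') := by
  induction A with
  | nil => exact hL
  | cons s A ih =>
    exact .skip _ _ _ _ _ (hA s (List.mem_cons_self ..))
      (ih fun t ht => hA t (List.mem_cons_of_mem _ ht))

open Classical in
/-- The cups with right vertex `j`, as a list. -/
noncomputable def cupsAt {n : ℕ} (w : Fin n → Bool) (j : Fin n) : List (Fin n × Fin n) :=
  ((List.finRange n).filter fun i => Cup w i j).map fun i => (i, j)

theorem cupsRightToLeft_eq {n : ℕ} (w : Fin n → Bool) :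
    cupsRightToLeft w = (List.finRange n).reverse.flatMap (cupsAt w) := rfl

theorem cup_of_mem_cupsAt {n : ℕ} {w : Fin n → Bool} {j : Fin n} {s : Fin n × Fin n}
    (hs : s ∈ cupsAt w j) : Cup w s.1 s.2 := by
  classical
  simp only [cupsAt, List.mem_map, List.mem_filter, decide_eq_true_eq] at hs
  obtain ⟨i, ⟨-, hi⟩, rfl⟩ := hs
  exact hi

section CupsAt

variable {w : Fin (m + 2) → Bool} {v : Fin m → Bool}

theorem Contracts.cupsAt_skip (h : Contracts hk w v) (j : Fin m) :
    cupsAt w (skip m k j) = (cupsAt v j).map (Prod.map (skip m k) (skip m k)) := by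
  classical
  obtain ⟨A, B, hAB, hAB'⟩ := exists_finRange_eq hk
  have hL : ¬ Cup w (delL hk) (skip m k j) := fun hc =>
    not_isDel_skip (hk := hk) j ((h.isDel_iff hc).1 (.inl rfl))
  have hR : ¬ Cup w (delR hk) (skip m k j) := fun hc =>
    not_isDel_skip (hk := hk) j ((h.isDel_iff hc).1 (.inr rfl))
  simp only [cupsAt, hAB, hAB', List.filter_append, List.filter_map, List.filter_cons, hL, hR,
    decide_false, Bool.false_eq_true, if_false, List.map_append, List.map_map, Function.comp_def,
    h.cup_skip_iff, Prod.map]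

theorem Contracts.cupsAt_delL (h : Contracts hk w v) : cupsAt w (delL hk) = [] := by
  classical
  rw [cupsAt, List.map_eq_nil_iff, List.filter_eq_nil_iff]
  intro x _
  rw [decide_eq_true_eq]
  intro hc
  obtain ⟨-, h'⟩ | ⟨i, j, -, h', -⟩ := h.cup_cases hc
  · exact delL_ne_delR hk h'
  · exact skip_ne_delL hk j h'.symm

theorem Contracts.cupsAt_delR (h : Contracts hk w v) :
    cupsAt w (delR hk) = [(delL hk, delR hk)] := by
  classical
  obtain ⟨A, B, -, hAB⟩ := exists_finRange_eq hk
  have hS : ∀ i, ¬ Cup w (skip m k i) (delR hk) := fun i hc =>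
    not_isDel_skip (hk := hk) i ((h.isDel_iff hc).2 (.inr rfl))
  have hR : ¬ Cup w (delR hk) (delR hk) := fun hc => lt_irrefl _ hc.lt
  simp [cupsAt, hAB, List.filter_map, h.cup_del, hR, hS, Function.comp_def]

theorem listContracts_cupsRightToLeft {w : Weight (m + 2)} {v : Weight m}
    (h : Contracts hk w.1 v.1) :
    ListContracts hk v true (cupsRightToLeft w.1) (cupsRightToLeft v.1) := by
  obtain ⟨A, B, hAB, hAB'⟩ := exists_finRange_eq hk
  have hmap : ∀ l : List (Fin m), (l.map (skip m k)).flatMap (cupsAt w.1) =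
      (l.flatMap (cupsAt v.1)).map (Prod.map (skip m k) (skip m k)) := fun l => by
    rw [List.flatMap_map, List.map_flatMap]
    simp only [h.cupsAt_skip]
  have hcup : ∀ l : List (Fin m), ∀ s ∈ l.flatMap (cupsAt v.1), Cup v.1 s.1 s.2 := fun l s hs => by
    obtain ⟨j, -, hj⟩ := List.mem_flatMap.1 hs
    exact cup_of_mem_cupsAt hj
  rw [cupsRightToLeft_eq, cupsRightToLeft_eq, hAB, hAB']
  simp only [List.reverse_append, List.reverse_cons, List.flatMap_append, ← List.map_reverse, hmap,
    List.flatMap_cons, List.flatMap_nil, h.cupsAt_delL, h.cupsAt_delR, List.append_nil,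
    List.append_assoc, List.nil_append]
  refine ListContracts.append_map (.del _ _ ?_) _ (hcup _)
  simpa using ListContracts.append_map .nil _ (hcup A.reverse)

end CupsAt

end Iterate

/-! ### The isomorphism -/

theorem Diagram.isOrientation_stack {n : ℕ} (x y : Diagram n) (hxy : x.cap = y.cup) :
    (Stacked.mk x.cup x.cap y.cap ∅).IsOrientation ![x.wt, y.wt] := by
  have hx := x.oriented_cap
  have hy := y.oriented_cup
  rw [← hxy] at hy
  refine ⟨x.oriented_cup, y.oriented_cap, fun i j z _ hij => ?_, fun i j z _ hij => ?_,
    fun i hi => ?_⟩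
  · fin_cases z
    · exact hx.1 i j hij
    · exact hy.1 i j hij
  · fin_cases z
    · exact hx.2.1 i j hij
    · exact hy.2.1 i j hij
  · have hray : Ray x.cap.1 i := fun j =>
      ⟨fun hj => (hi j).1 ⟨hj, Set.notMem_empty _⟩, fun hj => (hi j).2 ⟨hj, Set.notMem_empty _⟩⟩
    exact (hx.2.2 i hray).trans (hy.2.2 i hray).symm

section Iso

variable {m k : ℕ} (hk : k < m + 2) (hmk : m = 0 → k = 0)

theorem oriented_expand_iff (l ν : Weight m) :
    Oriented (expand hk hmk l).1 (expand hk hmk ν).1 ↔ Oriented l.1 ν.1 :=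
  (contracts_expand hmk l).oriented_iff (contracts_expand hmk ν)

/-- The oriented circle diagram whose three weights contract to those of `x`. -/
noncomputable def Diagram.expand (x : Diagram m) : Diagram (m + 2) where
  cup := ArcD.expand hk hmk x.cup
  wt := ArcD.expand hk hmk x.wt
  cap := ArcD.expand hk hmk x.cap
  oriented_cup := (oriented_expand_iff hk hmk _ _).2 x.oriented_cup
  oriented_cap := (oriented_expand_iff hk hmk _ _).2 x.oriented_cap

theorem Diagram.expand_injective : Function.Injective (Diagram.expand hk hmk) := by
  rintro ⟨a, b, c, _, _⟩ ⟨a', b', c', _, _⟩ h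
  have h1 := ArcD.expand_injective (hk := hk) hmk (congrArg Diagram.cup h)
  have h2 := ArcD.expand_injective (hk := hk) hmk (congrArg Diagram.wt h)
  have h3 := ArcD.expand_injective (hk := hk) hmk (congrArg Diagram.cap h)
  simp only at h1 h2 h3
  subst h1 h2 h3
  rfl

theorem Diagram.degree_expand (x : Diagram m) : (x.expand hk hmk).degree = x.degree :=
  congrArg₂ _ ((contracts_expand hmk _).cupDegree_eq (contracts_expand hmk _))
    ((contracts_expand hmk _).cupDegree_eq (contracts_expand hmk _))

theorem Diagram.contractible_expand (x : Diagram m) : (x.expand hk hmk).Contractible k :=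
  ⟨(contractible_iff hk _).2 (contracts_expand hmk _).delLabels,
    (contractible_iff hk _).2 (contracts_expand hmk _).delLabels,
    (contractible_iff hk _).2 (contracts_expand hmk _).delLabels⟩

theorem Diagram.Contractible.exists_expand_eq {x : Diagram (m + 2)} (hx : x.Contractible k) :
    ∃ y : Diagram m, y.cup = contract k x.cup ∧ y.wt = contract k x.wt ∧
      y.cap = contract k x.cap ∧ y.expand hk hmk = x := by
  obtain ⟨cup, wt, cap, h₁, h₂⟩ := x
  obtain ⟨hcup, hwt, hcap⟩ := hx
  have c₁ := contracts_contract ((contractible_iff hk _).1 hcup)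
  have c₂ := contracts_contract ((contractible_iff hk _).1 hwt)
  have c₃ := contracts_contract ((contractible_iff hk _).1 hcap)
  refine ⟨⟨contract k cup, contract k wt, contract k cap, (c₁.oriented_iff c₂).1 h₁,
    (c₃.oriented_iff c₂).1 h₂⟩, rfl, rfl, rfl, ?_⟩
  simp only [Diagram.expand, ← c₁.eq_expand hmk, ← c₂.eq_expand hmk, ← c₃.eq_expand hmk]

variable (𝕜 : Type*) [CommRing 𝕜]

/-- The linear embedding `𝔻_m → 𝔻_{m+2}` given by the inverse of the contraction. -/
noncomputable def expandLinear : ArcAlgebra 𝕜 m →ₗ[𝕜] ArcAlgebra 𝕜 (m + 2) :=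
  (Finsupp.lmapDomain 𝕜 𝕜 (Diagram.expand hk hmk) :
    (Diagram m →₀ 𝕜) →ₗ[𝕜] (Diagram (m + 2) →₀ 𝕜))

theorem expandLinear_diag (x : Diagram m) :
    expandLinear hk hmk 𝕜 (diag 𝕜 x) = diag 𝕜 (x.expand hk hmk) :=
  Finsupp.mapDomain_single

theorem expandLinear_injective : Function.Injective (expandLinear hk hmk 𝕜) :=
  Finsupp.mapDomain_injective (Diagram.expand_injective hk hmk)

theorem mulDiag_expand (x y : Diagram m) :
    mulDiag 𝕜 (x.expand hk hmk) (y.expand hk hmk) = expandLinear hk hmk 𝕜 (mulDiag 𝕜 x y) := by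
  classical
  unfold mulDiag
  by_cases hxy : x.cap = y.cup
  swap
  · rw [if_neg hxy, if_neg, map_zero]
    exact fun h => hxy (expand_injective hmk h)
  have hxy' : (x.expand hk hmk).cap = (y.expand hk hmk).cup := congrArg (expand hk hmk) hxy
  rw [if_pos hxy, if_pos hxy', map_sum]
  have hstack : StackContracts hk
      ⟨(x.expand hk hmk).cup, (x.expand hk hmk).cap, (y.expand hk hmk).cap, ∅⟩
      ⟨x.cup, x.cap, y.cap, ∅⟩ :=
    ⟨contracts_expand hmk _, contracts_expand hmk _, contracts_expand hmk _, fun i j => Iff.rfl⟩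
  have hlab : LabContracts hk ![(x.expand hk hmk).wt, (y.expand hk hmk).wt] ![x.wt, y.wt] := by
    intro z
    fin_cases z
    · exact contracts_expand hmk x.wt
    · exact contracts_expand hmk y.wt
  obtain ⟨hiter, hiter0⟩ := (listContracts_cupsRightToLeft (contracts_expand (hk := hk) hmk
    x.cap)).iterCoeff_eq hmk hstack rfl (fun _ => Set.notMem_empty _) hlab
    ((x.expand hk hmk).isOrientation_stack (y.expand hk hmk) hxy')
  symm
  refine Fintype.sum_of_injective (expand hk hmk) (expand_injective hmk) _ _ ?_ ?_
  · intro σ hσ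
    split_ifs with h
    · have := hiter0 ![σ, σ] ?_
      · change Stacked.iterCoeff (cupsRightToLeft (x.expand hk hmk).cap.1) _ _ _ = 0 at this
        rw [this, Int.cast_zero, zero_smul]
      · rintro ⟨σ', hσ'⟩
        exact hσ ⟨σ' 0, ((hσ' 0).eq_expand hmk).symm⟩
    · rfl
  · intro σ
    have hσ : LabContracts hk ![expand hk hmk σ, expand hk hmk σ] ![σ, σ] := by
      intro z
      fin_cases z <;> exact contracts_expand hmk σ
    have hiff : (Oriented (x.expand hk hmk).cup.1 (expand hk hmk σ).1 ∧
        Oriented (y.expand hk hmk).cap.1 (expand hk hmk σ).1) ↔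
        (Oriented x.cup.1 σ.1 ∧ Oriented y.cap.1 σ.1) :=
      and_congr (oriented_expand_iff hk hmk _ _) (oriented_expand_iff hk hmk _ _)
    by_cases h : Oriented x.cup.1 σ.1 ∧ Oriented y.cap.1 σ.1
    · rw [dif_pos h, dif_pos (hiff.2 h), map_smul, expandLinear_diag, ← hiter _ _ hσ]
      rfl
    · rw [dif_neg h, dif_neg (hiff.not.2 h), map_zero]

/-- An additive property of elements of `𝔻_n` holds if it holds for multiples of basis elements. -/
theorem ArcAlgebra.induction {n : ℕ} {P : ArcAlgebra 𝕜 n → Prop} (a : ArcAlgebra 𝕜 n) (h0 : P 0)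
    (hadd : ∀ a b, P a → P b → P (a + b)) (hdiag : ∀ (c : 𝕜) x, P (c • diag 𝕜 x)) : P a := by
  refine Finsupp.induction_linear (motive := P) a h0 hadd fun x c => ?_
  have : (c • diag 𝕜 x : ArcAlgebra 𝕜 n) = (Finsupp.single x c : Diagram n →₀ 𝕜) := by
    refine (Finsupp.smul_single c x (1 : 𝕜)).trans ?_
    rw [smul_eq_mul, mul_one]
  rw [← this]
  exact hdiag c x

theorem expandLinear_mul (a b : ArcAlgebra 𝕜 m) :
    expandLinear hk hmk 𝕜 (a * b) = expandLinear hk hmk 𝕜 a * expandLinear hk hmk 𝕜 b := by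
  induction a using ArcAlgebra.induction with
  | h0 => rw [zero_mul, map_zero, zero_mul]
  | hadd a a' ha ha' => rw [add_mul, map_add, map_add, add_mul, ha, ha']
  | hdiag c x =>
    induction b using ArcAlgebra.induction with
    | h0 => rw [mul_zero, map_zero, mul_zero]
    | hadd b b' hb hb' => rw [mul_add, map_add, map_add, mul_add, hb, hb']
    | hdiag d y =>
      simp only [smul_mul_assoc, mul_smul_comm, map_smul, diag_mul_diag, expandLinear_diag,
        mulDiag_expand]

/-- The embedding `𝔻_m → 𝔻_{m+2}` as a homomorphism of algebras. -/
noncomputable def expandHom : ArcAlgebra 𝕜 m →ₙₐ[𝕜] ArcAlgebra 𝕜 (m + 2) :=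
  { expandLinear hk hmk 𝕜 with
    map_zero' := (expandLinear hk hmk 𝕜).map_zero
    map_mul' := expandLinear_mul hk hmk 𝕜 }

theorem range_expandLinear : LinearMap.range (expandLinear hk hmk 𝕜) =
    Submodule.span 𝕜 {a | ∃ x : Diagram (m + 2), x.Contractible k ∧ a = diag 𝕜 x} := by
  apply le_antisymm
  · rintro _ ⟨a, rfl⟩
    induction a using ArcAlgebra.induction with
    | h0 => rw [map_zero]; exact zero_mem _
    | hadd a b ha hb => rw [map_add]; exact add_mem ha hb
    | hdiag c x =>
      rw [map_smul, expandLinear_diag]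
      exact Submodule.smul_mem _ _ (Submodule.subset_span ⟨_, x.contractible_expand hk hmk, rfl⟩)
  · rw [Submodule.span_le]
    rintro _ ⟨x, hx, rfl⟩
    obtain ⟨y, -, -, -, rfl⟩ := hx.exists_expand_eq hk hmk
    exact ⟨diag 𝕜 y, expandLinear_diag hk hmk 𝕜 y⟩

theorem mem_degreePart_iff {n : ℕ} (d : ℕ) (a : Diagram n →₀ 𝕜) :
    a ∈ (degreePart 𝕜 n d : Submodule 𝕜 (Diagram n →₀ 𝕜)) ↔ ∀ x, a x ≠ 0 → x.degree = d := by
  have key : degreePart 𝕜 n d =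
      (Finsupp.supported 𝕜 𝕜 {x : Diagram n | x.degree = d} : Submodule 𝕜 (Diagram n →₀ 𝕜)) := by
    rw [Finsupp.supported_eq_span_single, degreePart]
    refine congrArg (Submodule.span 𝕜) (Set.ext fun a => ?_)
    exact exists_congr fun x => and_congr_right fun _ => eq_comm
  rw [key]
  refine (Finsupp.mem_supported 𝕜 _).trans (forall_congr' fun x => ?_)
  rw [Finset.mem_coe, Finsupp.mem_support_iff]
  rfl

theorem expandLinear_mem_degreePart_iff (d : ℕ) (a : ArcAlgebra 𝕜 m) :
    expandLinear hk hmk 𝕜 a ∈ degreePart 𝕜 (m + 2) d ↔ a ∈ degreePart 𝕜 m d := by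
  have hinj := Diagram.expand_injective hk hmk
  refine (mem_degreePart_iff 𝕜 d _).trans (Iff.trans ?_ (mem_degreePart_iff 𝕜 d _).symm)
  constructor
  · intro h x hx
    rw [← x.degree_expand hk hmk]
    refine h _ ?_
    change Finsupp.mapDomain (Diagram.expand hk hmk) (show Diagram m →₀ 𝕜 from a) _ ≠ 0
    rwa [Finsupp.mapDomain_apply hinj]
  · intro h x hx
    change Finsupp.mapDomain (Diagram.expand hk hmk) (show Diagram m →₀ 𝕜 from a) x ≠ 0 at hx
    by_cases hr : x ∈ Set.range (Diagram.expand hk hmk)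
    · obtain ⟨y, rfl⟩ := hr
      rw [Finsupp.mapDomain_apply hinj] at hx
      rw [Diagram.degree_expand]
      exact h y hx
    · exact (hx (Finsupp.mapDomain_of_notMem_range _ _ hr)).elim

end Iso

end ArcD

theorem mainTheorem2 (𝕜 : Type*) [CommRing 𝕜] [IsDomain 𝕜] (m k : ℕ) (hk : k < m + 2)
    (hmk : m = 0 → k = 0) :
    ∃ S : NonUnitalSubalgebra 𝕜 (ArcD.ArcAlgebra 𝕜 (m + 2)),
      S.toSubmodule = Submodule.span 𝕜
        {a | ∃ x : ArcD.Diagram (m + 2), x.Contractible k ∧ a = ArcD.diag 𝕜 x} ∧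
      ∃ Φ : S ≃ₗ[𝕜] ArcD.ArcAlgebra 𝕜 m,
        (∀ (x : ArcD.Diagram (m + 2)) (a : S), x.Contractible k →
          (a : ArcD.ArcAlgebra 𝕜 (m + 2)) = ArcD.diag 𝕜 x →
          ∃ y : ArcD.Diagram m, y.cup = ArcD.contract k x.cup ∧ y.wt = ArcD.contract k x.wt ∧
            y.cap = ArcD.contract k x.cap ∧ Φ a = ArcD.diag 𝕜 y) ∧
        (∀ a b : S, Φ (a * b) = Φ a * Φ b) ∧
        ∀ (d : ℕ) (a : S), (a : ArcD.ArcAlgebra 𝕜 (m + 2)) ∈ ArcD.degreePart 𝕜 (m + 2) d ↔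
          Φ a ∈ ArcD.degreePart 𝕜 m d := by
  let ψ := ArcD.expandLinear hk hmk 𝕜
  have hψ : Function.Injective ψ := ArcD.expandLinear_injective hk hmk 𝕜
  let Ψ := LinearEquiv.ofInjective ψ hψ
  have hΨ : ∀ a : LinearMap.range ψ, ψ (Ψ.symm a) = a := fun a =>
    congrArg Subtype.val (Ψ.apply_symm_apply a)
  refine ⟨NonUnitalAlgHom.range (ArcD.expandHom hk hmk 𝕜), ?_, Ψ.symm, ?_, ?_, ?_⟩
  · rw [← ArcD.range_expandLinear hk hmk 𝕜]
    rfl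
  · intro x a hx ha
    obtain ⟨y, h₁, h₂, h₃, rfl⟩ := hx.exists_expand_eq hk hmk
    refine ⟨y, h₁, h₂, h₃, hψ ?_⟩
    exact ((hΨ a).trans ha).trans (ArcD.expandLinear_diag hk hmk 𝕜 y).symm
  · intro a b
    refine hψ ((hΨ (a * b)).trans ?_)
    refine Eq.trans ?_ (ArcD.expandLinear_mul hk hmk 𝕜 _ _).symm
    exact (congrArg₂ (· * ·) (hΨ a) (hΨ b)).symm
  · intro d a
    rw [← ArcD.expandLinear_mem_degreePart_iff hk hmk 𝕜]
    exact iff_of_eq (congrArg (· ∈ ArcD.degreePart 𝕜 (m + 2) d) (hΨ a).symm)
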